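/- **Gödel's first incompleteness theorem for the calculus of hereditarily finite sets.** *Language.* Terms are built from variables and a constant $0$ by the binary operation $x\lhd y$. Formulas are built from $t\in u$ and $t=u$ by $\lor$, $\neg$ and $\exists$, and are identified up to renaming of bound variables; $\land,\to,\leftrightarrow,\forall$ are the usual abbreviations, and $\mathrm{Fls}$ is $0\in 0$. A formula is *ground* if it has no free variables. It is *true* under an assignment of values to its free variables if it holds in the sense of Tarski in the universe of hereditarily finite sets, where $0$ is $\emptyset$, $x\lhd y$ is $x\cup\{y\}$ and $\in$ is membership. *Calculus.* Fix a formula $E$ (the extra axiom) that is true under every assignment. Let $H\vdash A$ be the least relation between sets $H$ of formulas and formulas $A$ such that $H\vdash A$ whenever $A\in H$ or $A$ is one of the following axioms: - $E$; - the propositional axioms $A\to A$, $\;A\to A\lor B$, $\;A\lor A\to A$, $\;A\lor(B\lor C)\to(A\lor B)\lor C$, $\;C\lor A\to(\neg C\lor B\to A\lor B)$; - reflexivity of $=$, and its congruence axioms for $=$, $\in$ and $\lhd$; - $A(i/t)\to\exists i\,A$; - $z=0\leftrightarrow\forall x\,(x\notin z)$ and $z=x\lhd y\leftrightarrow\forall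 u\,(u\in z\leftrightarrow u\in x\lor u=y)$; - the induction axioms $A(0)\to\bigl(\forall i\,\forall j\,(A(i)\to(A(j)\to A(i\lhd j)))\to\forall i\,A(i)\bigr)$, with $j\ne i$ not free in $A$; and such that - if $H\vdash A\to B$ and $H'\vdash A$, then $H\cup H'\vdash B$; - if $H\vdash A\to B$ and $i$ is not free in $B$ or in any member of $H$, then $H\vdash(\exists i\,A)\to B$. Write $\vdash A$ for $\emptyset\vdash A$. *Coding.* Put $\langle a,b\rangle=\{\{a\},\{a,b\}\}$, $\tau_0=\langle 0,0\rangle$, $\tau_{k+1}=\langle 0,\tau_k\rangle$, and let $\mathbf{k}$ be the numeral of $k$ as a von Neumann ordinal, all written as closed terms. Represent bound variables by de Bruijn indices. The code of $0$ is $0$, the code of the $i$-th variable ($i\ge0$) is $\mathbf{i{+}1}$, and that of the index $k$ is $\langle\tau_6,\mathbf{k}\rangle$; moreover $\ulcorner t\in u\urcorner=\langle\tau_0,\langle\ulcorner t\urcorner,\ulcorner u\urcorner\rangle\rangle$, and likewise for $\lhd$, $=$, $\lor$ with the tags $\tau_1,\tau_2,\tau_3$, while $\ulcorner\neg A\urcorner=\langle\tau_4,\ulcorner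 A\urcorner\rangle$ and $\ulcorner\exists A\urcorner=\langle\tau_5,\ulcorner A\urcorner\rangle$. *Provability predicate.* $\mathrm{Pf}(x)$ is the explicit formula of the language of HF which says: there are an ordinal $k$ and a sequence $s_0,\dots,s_k$ with $s_k=x$, each member of which is the code of an axiom listed above (including $E$) or follows from earlier members by the coded rule of modus ponens, the coded $\exists$-rule, or the coded rule of substituting a term for a free variable. The coded notions of term, formula, abstraction of a variable and substitution are expressed in the same way, by the existence of finite sequences that record the construction. *Theorem.* Suppose that the calculus is consistent, i.e. $\not\vdash\mathrm{Fls}$. Then there is a ground formula $\delta$ such that $$\vdash\delta\leftrightarrow\neg\mathrm{Pf}(\ulcorner\delta\urcorner),\qquad \not\vdash\delta,\qquad \not\vdash\neg\delta,$$ and $\delta$ is true (under every assignment). -/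

import Mathlib

/-! ## The hereditarily finite sets

The universe of hereditarily finite sets, in Ackermann's presentation: the natural number `x`
stands for the finite set of all `y` such that the binary digit number `y` of `x` is `1`.
The facts `HFSet.ext`, `HFSet.finite_mem`, `HFSet.exists_of_finset` and `HFSet.mem_wf` say that
this is the universe in which the sets are exactly the finite sets of sets, built up from
below. -/

/-- The type of hereditarily finite sets. -/
def HFSet : Type := ℕ

namespace HFSet

/-- Membership: `y ∈ x` iff the `y`-th binary digit of `x` is `1`. -/
instance : Membership HFSet HFSet := ⟨fun x y => Nat.testBit x y = true⟩

/-- The empty set. -/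
def empty : HFSet := (0 : ℕ)

/-- Augmentation: `eats x y` is the set `x ∪ {y}`. -/
def eats (x y : HFSet) : HFSet := Nat.lor x (Nat.pow 2 y)

theorem mem_def (y x : HFSet) : y ∈ x ↔ Nat.testBit x y = true := Iff.rfl

theorem not_mem_empty (y : HFSet) : ¬ y ∈ empty :=
  fun h => absurd ((Nat.zero_testBit y).symm.trans h) Bool.false_ne_true

theorem mem_eats (z x y : HFSet) : z ∈ eats x y ↔ z ∈ x ∨ z = y := by
  have key : ∀ a b c : ℕ, Nat.testBit (a ||| 2 ^ b) c = true ↔ Nat.testBit a c = true ∨ c = b := by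
    intro a b c
    rw [Nat.testBit_or, Nat.testBit_two_pow, Bool.or_eq_true, decide_eq_true_iff, eq_comm (a := b)]
  exact key x y z

theorem ext {x y : HFSet} (h : ∀ z, z ∈ x ↔ z ∈ y) : x = y :=
  Nat.eq_of_testBit_eq fun i => Bool.eq_iff_iff.mpr (h i)

theorem lt_of_mem {y x : HFSet} (h : y ∈ x) : Nat.lt y x :=
  lt_of_lt_of_le (Nat.lt_two_pow_self (n := y)) (Nat.ge_two_pow_of_testBit h)

theorem mem_wf : WellFounded (fun y x : HFSet => y ∈ x) :=
  Subrelation.wf (fun h => lt_of_mem h) Nat.lt_wfRel.wf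

theorem finite_mem (x : HFSet) : {y | y ∈ x}.Finite :=
  Set.Finite.subset (Set.finite_lt_nat x) fun _ h => lt_of_mem h

theorem exists_of_finset (s : Finset HFSet) : ∃ x : HFSet, ∀ y, y ∈ x ↔ y ∈ s := by
  classical
  induction s using Finset.induction_on with
  | empty => exact ⟨empty, fun y => by simp [not_mem_empty]⟩
  | insert a s _ ih =>
    obtain ⟨x, hx⟩ := ih
    exact ⟨eats x a, fun y => by rw [mem_eats, hx, Finset.mem_insert, or_comm]⟩

end HFSet

namespace HFCalculus

/-! ## Syntax

Free variables are named by natural numbers; bound variables are nameless (de Bruijn indices),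
so that formulas which differ only in the names of their bound variables are equal.
`Tm n` and `Fm n` are the terms and formulas in which the indices `0, …, n - 1` may occur
unbound, `0` being the innermost.  The terms and formulas of the calculus are those of
`Tm 0` and `Fm 0`. -/

/-- Terms of HF. -/
inductive Tm (n : ℕ) : Type
  | zero : Tm n
  | var (i : ℕ) : Tm n
  | ind (k : Fin n) : Tm n
  | eats (t u : Tm n) : Tm n

/-- Formulas of HF. -/
inductive Fm : ℕ → Type
  | mem {n : ℕ} (t u : Tm n) : Fm n
  | eq {n : ℕ} (t u : Tm n) : Fm n
  | disj {n : ℕ} (A B : Fm n) : Fm n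
  | neg {n : ℕ} (A : Fm n) : Fm n
  | ex {n : ℕ} (A : Fm (n + 1)) : Fm n

/-- The same term, seen below one more quantifier. -/
def Tm.lift {n : ℕ} : Tm n → Tm (n + 1)
  | .zero => .zero
  | .var i => .var i
  | .ind k => .ind k.succ
  | .eats t u => .eats t.lift u.lift

/-- Terms are silently lifted when they are used below quantifiers. -/
instance {n : ℕ} : Coe (Tm n) (Tm (n + 1)) := ⟨Tm.lift⟩

/-- Free (named) variables of a term. -/
def Tm.fv {n : ℕ} : Tm n → Finset ℕ
  | .zero => ∅
  | .var i => {i}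
  | .ind _ => ∅
  | .eats t u => t.fv ∪ u.fv

/-- Free (named) variables of a formula. -/
def Fm.fv : {n : ℕ} → Fm n → Finset ℕ
  | _, .mem t u => t.fv ∪ u.fv
  | _, .eq t u => t.fv ∪ u.fv
  | _, .disj A B => A.fv ∪ B.fv
  | _, .neg A => A.fv
  | _, .ex A => A.fv

/-- A ground formula (sentence): no free variables. -/
def Fm.Ground (A : Fm 0) : Prop := A.fv = ∅

/-- Substitution of the term `x` for the free variable `i` in a term. -/
def Tm.subst {n : ℕ} (t : Tm n) (i : ℕ) (x : Tm n) : Tm n :=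
  match t with
  | .zero => .zero
  | .var k => if i = k then x else .var k
  | .ind k => .ind k
  | .eats t u => .eats (t.subst i x) (u.subst i x)

/-- Substitution `A(i ::= x)` of the term `x` for the free variable `i` in a formula. -/
def Fm.subst (i : ℕ) : {n : ℕ} → Tm n → Fm n → Fm n
  | _, x, .mem t u => .mem (t.subst i x) (u.subst i x)
  | _, x, .eq t u => .eq (t.subst i x) (u.subst i x)
  | _, x, .disj A B => .disj (A.subst i x) (B.subst i x)
  | _, x, .neg A => .neg (A.subst i x)
  | _, x, .ex A => .ex (A.subst i x.lift)

/-- Abstraction: the free variable `i` becomes a new outermost index. -/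
def Tm.abst {n : ℕ} (i : ℕ) : Tm n → Tm (n + 1)
  | .zero => .zero
  | .var k => if i = k then .ind (Fin.last n) else .var k
  | .ind k => .ind k.castSucc
  | .eats t u => .eats (t.abst i) (u.abst i)

/-- Abstraction: the free variable `i` becomes a new outermost index. -/
def Fm.abst (i : ℕ) : {n : ℕ} → Fm n → Fm (n + 1)
  | _, .mem t u => .mem (t.abst i) (u.abst i)
  | _, .eq t u => .eq (t.abst i) (u.abst i)
  | _, .disj A B => .disj (A.abst i) (B.abst i)
  | _, .neg A => .neg (A.abst i)
  | _, .ex A => .ex (A.abst i)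

local infix:75 " IN " => Fm.mem
local infix:75 " EQ " => Fm.eq
local infixr:65 " OR " => Fm.disj

/-- Conjunction. -/
def Fm.conj {n : ℕ} (A B : Fm n) : Fm n := .neg (.disj (.neg A) (.neg B))

/-- Implication. -/
def Fm.imp {n : ℕ} (A B : Fm n) : Fm n := .disj (.neg A) B

local infixr:70 " AND " => Fm.conj
local infixr:60 " IMP " => Fm.imp

/-- Equivalence. -/
def Fm.iff {n : ℕ} (A B : Fm n) : Fm n := (A IMP B) AND (B IMP A)

local infix:55 " IFF " => Fm.iff

/-- The existential quantifier `∃ i. A` over the named variable `i`. -/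
def Fm.exN (i : ℕ) (A : Fm 0) : Fm 0 := .ex (A.abst i)

/-- The universal quantifier `∀ i. A` over the named variable `i`. -/
def Fm.allN (i : ℕ) (A : Fm 0) : Fm 0 := .neg (.exN i (.neg A))

/-- Falsity. -/
def Fm.fls : Fm 0 := .zero IN .zero

/-! ## Tarski semantics -/

/-- Value of a term: `e` interprets the free variables, `b` the unbound indices. -/
def Tm.eval {n : ℕ} (e : ℕ → HFSet) (b : Fin n → HFSet) : Tm n → HFSet
  | .zero => HFSet.empty
  | .var i => e i
  | .ind k => b k
  | .eats t u => HFSet.eats (t.eval e b) (u.eval e b)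

/-- Truth of a formula in the universe of hereditarily finite sets. -/
def Fm.eval (e : ℕ → HFSet) : {n : ℕ} → (Fin n → HFSet) → Fm n → Prop
  | _, b, .mem t u => t.eval e b ∈ u.eval e b
  | _, b, .eq t u => t.eval e b = u.eval e b
  | _, b, .disj A B => A.eval e b ∨ B.eval e b
  | _, b, .neg A => ¬ A.eval e b
  | _, b, .ex A => ∃ x : HFSet, A.eval e (Fin.cons x b)

/-- `A` is true under the assignment `e` of values to the free variables. -/
def Fm.Holds (e : ℕ → HFSet) (A : Fm 0) : Prop := A.eval e Fin.elim0

/-! ## The HF calculus -/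

/-- Axiom schemes of propositional logic. -/
inductive BooleanAx : Fm 0 → Prop
  | ident (A : Fm 0) : BooleanAx (A IMP A)
  | disjI1 (A B : Fm 0) : BooleanAx (A IMP (A OR B))
  | disjCont (A : Fm 0) : BooleanAx ((A OR A) IMP A)
  | disjAssoc (A B C : Fm 0) : BooleanAx ((A OR (B OR C)) IMP ((A OR B) OR C))
  | disjConj (A B C : Fm 0) : BooleanAx ((C OR A) IMP ((.neg C OR B) IMP (A OR B)))

/-- Reflexivity of equality. -/
def reflAx : Fm 0 := .var 1 EQ .var 1

/-- Congruence of equality. -/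
def eqCongAx : Fm 0 :=
  (.var 1 EQ .var 2 AND .var 3 EQ .var 4) IMP (.var 1 EQ .var 3 IMP .var 2 EQ .var 4)

/-- Congruence of membership. -/
def memCongAx : Fm 0 :=
  (.var 1 EQ .var 2 AND .var 3 EQ .var 4) IMP (.var 1 IN .var 3 IMP .var 2 IN .var 4)

/-- Congruence of augmentation. -/
def eatsCongAx : Fm 0 :=
  (.var 1 EQ .var 2 AND .var 3 EQ .var 4) IMP
    (.eats (.var 1) (.var 3) EQ .eats (.var 2) (.var 4))

/-- The equality axioms. -/
def EqualityAx (A : Fm 0) : Prop :=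
  A = reflAx ∨ A = eqCongAx ∨ A = memCongAx ∨ A = eatsCongAx

/-- The quantifier axioms `A(i ::= x) → ∃ i. A`. -/
inductive SpecialAx : Fm 0 → Prop
  | intro (A : Fm 0) (i : ℕ) (x : Tm 0) : SpecialAx (A.subst i x IMP .exN i A)

/-- `z = 0 ↔ ∀ x. x ∉ z`. -/
def hf1 : Fm 0 := .var 0 EQ .zero IFF .allN 1 (.neg (.var 1 IN .var 0))

/-- `z = x ◁ y ↔ ∀ u. u ∈ z ↔ u ∈ x ∨ u = y`. -/
def hf2 : Fm 0 :=
  .var 0 EQ .eats (.var 1) (.var 2) IFF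
    .allN 3 (.var 3 IN .var 0 IFF (.var 3 IN .var 1 OR .var 3 EQ .var 2))

/-- The axioms HF1 and HF2. -/
def HFAx (A : Fm 0) : Prop := A = hf1 ∨ A = hf2

/-- The induction scheme
`A(0) → (∀ i j. A(i) → A(j) → A(i ◁ j)) → ∀ i. A(i)`. -/
inductive InductionAx : Fm 0 → Prop
  | intro (A : Fm 0) (i j : ℕ) (hij : j ≠ i) (hj : j ∉ A.fv) :
      InductionAx (A.subst i .zero IMP
        (.allN i (.allN j (A IMP (A.subst i (.var j) IMP
          A.subst i (.eats (.var i) (.var j))))) IMP .allN i A))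

/-- `HFThm E H A`: the formula `A` is provable from the set `H` of hypotheses in the HF calculus
extended by the extra axiom `E`. -/
inductive HFThm (E : Fm 0) : Set (Fm 0) → Fm 0 → Prop
  | hyp {H : Set (Fm 0)} {A : Fm 0} : A ∈ H → HFThm E H A
  | extra {H : Set (Fm 0)} : HFThm E H E
  | bool {H : Set (Fm 0)} {A : Fm 0} : BooleanAx A → HFThm E H A
  | eq {H : Set (Fm 0)} {A : Fm 0} : EqualityAx A → HFThm E H A
  | spec {H : Set (Fm 0)} {A : Fm 0} : SpecialAx A → HFThm E H A
  | hf {H : Set (Fm 0)} {A : Fm 0} : HFAx A → HFThm E H A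
  | ind {H : Set (Fm 0)} {A : Fm 0} : InductionAx A → HFThm E H A
  | mp {H H' : Set (Fm 0)} {A B : Fm 0} :
      HFThm E H (A IMP B) → HFThm E H' A → HFThm E (H ∪ H') B
  | exists {H : Set (Fm 0)} {A B : Fm 0} {i : ℕ} :
      HFThm E H (A IMP B) → i ∉ B.fv → (∀ C ∈ H, i ∉ C.fv) → HFThm E H (.exN i A IMP B)

/-! ## Coding of the syntax by closed terms of HF -/

/-- `x ∪ {x}`. -/
def succ {n : ℕ} (t : Tm n) : Tm n := .eats t t

/-- The ordered pair `{{a}, {a, b}}`. -/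
def hpair {n : ℕ} (a b : Tm n) : Tm n :=
  .eats (.eats .zero (.eats (.eats .zero b) a)) (.eats (.eats .zero a) a)

/-- The numeral of `k` (a von Neumann ordinal). -/
def ordOf {n : ℕ} : ℕ → Tm n
  | 0 => .zero
  | k + 1 => succ (ordOf k)

/-- Tags for the syntactic constructors. -/
def htuple {n : ℕ} : ℕ → Tm n
  | 0 => hpair .zero .zero
  | k + 1 => hpair .zero (htuple k)

/-! The constructors, as operations on codes. -/

def qMem {n : ℕ} (t u : Tm n) : Tm n := hpair (htuple 0) (hpair t u)
def qEats {n : ℕ} (t u : Tm n) : Tm n := hpair (htuple 1) (hpair t u)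
def qEq {n : ℕ} (t u : Tm n) : Tm n := hpair (htuple 2) (hpair t u)
def qDisj {n : ℕ} (t u : Tm n) : Tm n := hpair (htuple 3) (hpair t u)
def qNeg {n : ℕ} (t : Tm n) : Tm n := hpair (htuple 4) t
def qEx {n : ℕ} (t : Tm n) : Tm n := hpair (htuple 5) t
def qInd {n : ℕ} (t : Tm n) : Tm n := hpair (htuple 6) t
def qImp {n : ℕ} (t u : Tm n) : Tm n := qDisj (qNeg t) u
def qAll {n : ℕ} (t : Tm n) : Tm n := qNeg (qEx (qNeg t))

/-- The code of a term, as a closed term. -/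
def Tm.quot {m n : ℕ} : Tm m → Tm n
  | .zero => .zero
  | .var i => ordOf (i + 1)
  | .ind k => qInd (ordOf k)
  | .eats t u => qEats t.quot u.quot

/-- The code `⌜A⌝` of a formula, as a closed term. -/
def Fm.quot {n : ℕ} : {m : ℕ} → Fm m → Tm n
  | _, .mem t u => qMem t.quot u.quot
  | _, .eq t u => qEq t.quot u.quot
  | _, .disj A B => qDisj A.quot B.quot
  | _, .neg A => qNeg A.quot
  | _, .ex A => qEx A.quot

/-! ## Formulas of HF that express the syntax of the calculus

Every predicate below is a formula of HF, depending on terms of HF. A function between brackets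
receives the bound variable. -/

/-- `∃ x. A x`. -/
def exB {n : ℕ} (A : Tm (n + 1) → Fm (n + 1)) : Fm n := .ex (A (.ind 0))

/-- The bounded quantifier `∀ x ∈ t. A x`. -/
def all2 {n : ℕ} (t : Tm n) (A : Tm (n + 1) → Fm (n + 1)) : Fm n :=
  .neg (exB fun x => .neg (x IN t IMP A x))

/-- `t ⊆ u`. -/
def subsetP {n : ℕ} (t u : Tm n) : Fm n := all2 t fun z => z IN u

/-- `x` is an ordinal (a natural number): a transitive set of transitive sets. -/
def ordP {n : ℕ} (x : Tm n) : Fm n :=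
  all2 x fun y => subsetP y x AND all2 y fun z => subsetP z y

/-- `s` is a function (a single-valued set of ordered pairs). -/
def functionP {n : ℕ} (s : Tm n) : Fm n :=
  all2 s fun p => all2 s fun q =>
    exB fun x => exB fun y => exB fun x' => exB fun y' =>
      p EQ hpair x y AND q EQ hpair x' y' AND (.neg (x EQ x') OR y EQ y')

/-- The domain of `s` includes `d`. -/
def domainInclP {n : ℕ} (s d : Tm n) : Fm n := all2 d fun x => exB fun y => hpair x y IN s

/-- `s` is a sequence with `k + 1` members `s 0, …, s k`, the last one being `y`. -/
def lstSeqP {n : ℕ} (s k y : Tm n) : Fm n :=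
  ordP k AND domainInclP s (succ k) AND functionP s AND hpair k y IN s

/-- There is a sequence `s 0, …, s k` with last member `y`, each member `x` of which satisfies
`base x` or `rule a b x` for two members `a`, `b` that come before it. -/
def derivP {n : ℕ} (y : Tm n)
    (base : Tm (n + 1 + 1 + 1 + 1) → Fm (n + 1 + 1 + 1 + 1))
    (rule : Tm (n + 1 + 1 + 1 + 1 + 1 + 1 + 1 + 1) → Tm (n + 1 + 1 + 1 + 1 + 1 + 1 + 1 + 1) →
      Tm (n + 1 + 1 + 1 + 1 + 1 + 1 + 1 + 1) → Fm (n + 1 + 1 + 1 + 1 + 1 + 1 + 1 + 1)) : Fm n :=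
  exB fun k => exB fun s => lstSeqP s k y AND
    all2 (succ k) fun i => exB fun x => hpair i x IN s AND
      (base x OR
        exB fun j => exB fun l => exB fun a => exB fun b =>
          j IN i AND l IN i AND hpair j a IN s AND hpair l b IN s AND rule a b x)

/-- `x` codes a variable. -/
def varP {n : ℕ} (x : Tm n) : Fm n := ordP x AND .zero IN x

/-- `x` codes a de Bruijn index. -/
def indP {n : ℕ} (x : Tm n) : Fm n := exB fun k => ordP k AND x EQ qInd k

/-- `t` codes a term. -/
def termP {n : ℕ} (t : Tm n) : Fm n :=
  derivP t (fun x => x EQ .zero OR varP x) (fun a b x => x EQ qEats a b)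

/-- `t'` codes the result of replacing the variable `v` by `u` in the term `t`
(where `t` may contain de Bruijn indices). -/
def stTermP {n : ℕ} (v u t t' : Tm n) : Fm n :=
  derivP (hpair t t')
    (fun x => x EQ hpair v u OR
      exB fun z => x EQ hpair z z AND
        (z EQ .zero OR indP z OR (varP z AND .neg (z EQ v))))
    (fun a b x => exB fun p => exB fun p' => exB fun q => exB fun q' =>
      a EQ hpair p p' AND b EQ hpair q q' AND x EQ hpair (qEats p q) (qEats p' q'))

/-- `x` codes an atomic formula. -/
def atomicP {n : ℕ} (x : Tm n) : Fm n :=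
  exB fun t => exB fun u => termP t AND termP u AND (x EQ qEq t u OR x EQ qMem t u)

/-- `x'` codes the result of replacing the variable `v` by `u` in the atomic formula `x`. -/
def stAtomicP {n : ℕ} (v u x x' : Tm n) : Fm n :=
  exB fun p => exB fun p' => exB fun q => exB fun q' =>
    stTermP v u p p' AND stTermP v u q q' AND
      ((x EQ qEq p q AND x' EQ qEq p' q') OR (x EQ qMem p q AND x' EQ qMem p' q'))

/-- `x'` codes the abstraction of the formula `x` over the variable `v`, which becomes the
index `i` at the top level and larger indices below quantifiers. -/
def abstFormP {n : ℕ} (v i x x' : Tm n) : Fm n :=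
  varP v AND ordP i AND
  derivP (hpair i (hpair x x'))
    (fun y => exB fun d => exB fun z => exB fun z' =>
      y EQ hpair d (hpair z z') AND ordP d AND stAtomicP v (qInd d) z z')
    (fun a b y => exB fun d => exB fun p => exB fun p' =>
      (a EQ hpair d (hpair p p') AND
        ((y EQ hpair d (hpair (qNeg p) (qNeg p'))) OR
          exB fun q => exB fun q' => b EQ hpair d (hpair q q') AND
            y EQ hpair d (hpair (qDisj p q) (qDisj p' q')))) OR
      (a EQ hpair (succ d) (hpair p p') AND y EQ hpair d (hpair (qEx p) (qEx p'))))

/-- `x'` codes the result of substituting the term `u` for the variable `v` in the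
formula `x`. -/
def substFormP {n : ℕ} (v u x x' : Tm n) : Fm n :=
  varP v AND termP u AND
  derivP (hpair x x')
    (fun y => exB fun z => exB fun z' => y EQ hpair z z' AND stAtomicP v u z z')
    (fun a b y => exB fun p => exB fun p' => a EQ hpair p p' AND
      (y EQ hpair (qNeg p) (qNeg p') OR y EQ hpair (qEx p) (qEx p') OR
        exB fun q => exB fun q' => b EQ hpair q q' AND
          y EQ hpair (qDisj p q) (qDisj p' q')))

/-- `y` codes a formula constructed from the formulas coded by `u` and `w`. -/
def makeFormP {n : ℕ} (y u w : Tm n) : Fm n :=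
  y EQ qDisj u w OR y EQ qNeg u OR
    exB fun v => exB fun u' => abstFormP v .zero u u' AND y EQ qEx u'

/-- `y` codes a formula. -/
def formP {n : ℕ} (y : Tm n) : Fm n :=
  derivP y (fun x => atomicP x) (fun a b x => makeFormP x a b)

/-- The variable `v` does not occur free in the formula `x`. -/
def varNonOccFormP {n : ℕ} (v x : Tm n) : Fm n := formP x AND substFormP v .zero x x

/-- `y` codes an axiom of propositional logic. -/
def booleanAxP {n : ℕ} (y : Tm n) : Fm n :=
  exB fun a => exB fun b => exB fun c => formP a AND formP b AND formP c AND
    (y EQ qImp a a OR y EQ qImp a (qDisj a b) OR y EQ qImp (qDisj a a) a OR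
      y EQ qImp (qDisj a (qDisj b c)) (qDisj (qDisj a b) c) OR
      y EQ qImp (qDisj c a) (qImp (qDisj (qNeg c) b) (qDisj a b)))

/-- `y` codes an equality axiom. -/
def equalityAxP {n : ℕ} (y : Tm n) : Fm n :=
  y EQ reflAx.quot OR y EQ eqCongAx.quot OR y EQ memCongAx.quot OR y EQ eatsCongAx.quot

/-- `y` codes one of the axioms HF1, HF2. -/
def hfAxP {n : ℕ} (y : Tm n) : Fm n := y EQ hf1.quot OR y EQ hf2.quot

/-- `y` codes a quantifier axiom. -/
def specialAxP {n : ℕ} (y : Tm n) : Fm n :=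
  exB fun v => exB fun u => exB fun x => exB fun sx => exB fun ax =>
    varP v AND termP u AND formP x AND substFormP v u x sx AND abstFormP v .zero x ax AND
      y EQ qImp sx (qEx ax)

/-- `y` codes an instance of the induction scheme. -/
def inductionAxP {n : ℕ} (y : Tm n) : Fm n :=
  exB fun v => exB fun w => exB fun x => exB fun x0 => exB fun xw => exB fun xvw =>
    exB fun allw => exB fun allvw => exB fun ax =>
      varP v AND varP w AND .neg (w EQ v) AND varNonOccFormP w x AND
      substFormP v .zero x x0 AND substFormP v w x xw AND substFormP v (qEats v w) x xvw AND
      abstFormP w .zero (qImp x (qImp xw xvw)) allw AND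
      abstFormP v .zero (qAll allw) allvw AND abstFormP v .zero x ax AND
      y EQ qImp x0 (qImp (qAll allvw) (qAll ax))

/-- `y` codes an axiom of the calculus with the extra axiom `E`. -/
def axiomP (E : Fm 0) {n : ℕ} (y : Tm n) : Fm n :=
  y EQ E.quot OR booleanAxP y OR equalityAxP y OR hfAxP y OR specialAxP y OR inductionAxP y

/-- `z` follows from `x` and `y` by modus ponens. -/
def modPonP {n : ℕ} (x y z : Tm n) : Fm n := y EQ qImp x z

/-- `q` follows from `p` by the rule for the existential quantifier. -/
def existsP {n : ℕ} (p q : Tm n) : Fm n :=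
  exB fun v => exB fun x => exB fun x' => exB fun y =>
    varP v AND formP x AND varNonOccFormP v y AND abstFormP v .zero x x' AND
      p EQ qImp x y AND q EQ qImp (qEx x') y

/-- `q` follows from `p` by the (admissible) rule of substitution. -/
def substP {n : ℕ} (p q : Tm n) : Fm n :=
  exB fun v => exB fun u => varP v AND termP u AND substFormP v u p q

/-- The provability predicate: `t` codes the last member of a sequence of formulas, each of
which is an axiom or follows from earlier members by a rule of inference. -/
def pfP (E : Fm 0) {n : ℕ} (t : Tm n) : Fm n :=
  derivP t (fun x => axiomP E x)
    (fun a b x => modPonP a b x OR existsP a x OR substP a x)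

end HFCalculus

/-! The proof is semantic. It rests on two facts about the sentence δ = `goedelSentence E`.

Adequacy (`sat_pfP_quot_iff`): `pfP E ⌜A⌝` is true among the hereditarily finite sets exactly when
`A` is provable. Fixed point (`goedelSentence_fixed_point`): δ ↔ ¬Pf⌜δ⌝ is provable; its semantic
form `sat_goedelSentence` holds in every `HFModel`. Together they say that δ is true in HF iff it is
not provable. If δ were provable it would be true by soundness (`HFThm.sound`, where the truth of
`E` enters), hence not provable. So δ is unprovable, therefore true, and ¬δ, being false, is
unprovable by soundness again. No derivability conditions and no formalised Σ₁-completeness are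
needed.

The fixed point is not derived inside the calculus. It is checked in an arbitrary model and
transferred by a Henkin completeness theorem (`HFThm.complete`). Such a model may be nonstandard,
and only the membership laws of 0 and ◁ are kept, so the function sending a code to its quotation is
defined by generated sets of pairs (`quoteP`). On standard codes its value is determined by external
induction on the term (`sat_quoteP_iff`). The diagonal sentence has the form ∃x (x = ⌜A⌝ ∧ A), whose
code is built from ⌜A⌝ and ⌜⌜A⌝⌝ by constructors alone, so no substitution function has to be
represented.

For adequacy, all recursive coded notions are instances of `derivP`. Over HF, `sat_derivP` turns
"there is a sequence" into an inductive predicate `Deriv`. Since coding is injective, induction on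
`Deriv` and on syntax identifies each coded notion with the real one. -/

namespace HFCalculus

local infix:75 " IN " => Fm.mem
local infix:75 " EQ " => Fm.eq
local infixr:65 " OR " => Fm.disj
local infixr:70 " AND " => Fm.conj
local infixr:60 " IMP " => Fm.imp
local infix:55 " IFF " => Fm.iff

/-! ## Structures for the language of HF -/

/-- A structure for the language of HF; equality is interpreted as equality. -/
class HFStruct (M : Type) where
  zero : M
  eats : M → M → M
  mem : M → M → Prop

instance : HFStruct HFSet := ⟨HFSet.empty, HFSet.eats, fun x y => x ∈ y⟩

section Semantics

variable {M : Type} [HFStruct M]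

/-- Value of a term in a structure. -/
def Tm.val {n : ℕ} (e : ℕ → M) (b : Fin n → M) : Tm n → M
  | .zero => HFStruct.zero
  | .var i => e i
  | .ind k => b k
  | .eats t u => HFStruct.eats (t.val e b) (u.val e b)

/-- Satisfaction of a formula in a structure. -/
def Fm.sat (e : ℕ → M) : {n : ℕ} → (Fin n → M) → Fm n → Prop
  | _, b, .mem t u => HFStruct.mem (t.val e b) (u.val e b)
  | _, b, .eq t u => t.val e b = u.val e b
  | _, b, .disj A B => A.sat e b ∨ B.sat e b
  | _, b, .neg A => ¬ A.sat e b
  | _, b, .ex A => ∃ x : M, A.sat e (Fin.cons x b)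

variable {n : ℕ} (e : ℕ → M) (b : Fin n → M)

@[simp] theorem Tm.val_zero : (Tm.zero : Tm n).val e b = HFStruct.zero := rfl
@[simp] theorem Tm.val_var (i : ℕ) : (Tm.var i : Tm n).val e b = e i := rfl
@[simp] theorem Tm.val_ind (k : Fin n) : (Tm.ind k : Tm n).val e b = b k := rfl
@[simp] theorem Tm.val_eats (t u : Tm n) :
    (Tm.eats t u).val e b = HFStruct.eats (t.val e b) (u.val e b) := rfl

@[simp] theorem Fm.sat_mem (t u : Tm n) :
    (t IN u).sat e b ↔ HFStruct.mem (t.val e b) (u.val e b) := Iff.rfl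
@[simp] theorem Fm.sat_eq (t u : Tm n) : (t EQ u).sat e b ↔ t.val e b = u.val e b := Iff.rfl
@[simp] theorem Fm.sat_disj (A B : Fm n) : (A OR B).sat e b ↔ A.sat e b ∨ B.sat e b := Iff.rfl
@[simp] theorem Fm.sat_neg (A : Fm n) : A.neg.sat e b ↔ ¬ A.sat e b := Iff.rfl
@[simp] theorem Fm.sat_ex (A : Fm (n + 1)) :
    A.ex.sat e b ↔ ∃ x : M, A.sat e (Fin.cons x b) := Iff.rfl
@[simp] theorem Fm.sat_conj (A B : Fm n) : (A AND B).sat e b ↔ A.sat e b ∧ B.sat e b := by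
  simp [Fm.conj, not_or]
@[simp] theorem Fm.sat_imp (A B : Fm n) : (A IMP B).sat e b ↔ (A.sat e b → B.sat e b) := by
  simp [Fm.imp, imp_iff_not_or]
@[simp] theorem Fm.sat_iff (A B : Fm n) : (A IFF B).sat e b ↔ (A.sat e b ↔ B.sat e b) := by
  simp [Fm.iff, iff_iff_implies_and_implies]

@[simp] theorem Tm.val_lift (x : M) (t : Tm n) : t.lift.val e (Fin.cons x b) = t.val e b := by
  induction t <;> simp_all [Tm.lift]

@[simp] theorem sat_exB (A : Tm (n + 1) → Fm (n + 1)) :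
    (exB A).sat e b ↔ ∃ x : M, (A (.ind 0)).sat e (Fin.cons x b) := Iff.rfl

@[simp] theorem sat_all2 (t : Tm n) (A : Tm (n + 1) → Fm (n + 1)) :
    (all2 t A).sat e b ↔
      ∀ x : M, HFStruct.mem x (t.val e b) → (A (.ind 0)).sat e (Fin.cons x b) := by
  simp [all2]

/-- Abstraction creates the outermost index, so its value enters the assignment at the end
(`Fin.snoc`), whereas a quantifier extends it at the front (`Fin.cons`). The two coincide at depth
0, which is what `Fm.sat_exN` uses. -/
theorem Tm.val_abst (i : ℕ) (x : M) (t : Tm n) :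
    (t.abst i).val e (Fin.snoc b x : Fin (n + 1) → M) = t.val (Function.update e i x) b := by
  induction t with
  | zero => rfl
  | var k =>
    by_cases h : i = k
    · subst h; simp [Tm.abst]
    · simp [Tm.abst, h, Function.update_of_ne (Ne.symm h)]
  | ind k => simp [Tm.abst]
  | eats t u iht ihu => simp [Tm.abst, iht, ihu]

theorem Fm.sat_abst (e : ℕ → M) (i : ℕ) (x : M) {n : ℕ} (b : Fin n → M) (A : Fm n) :
    (A.abst i).sat e (Fin.snoc b x : Fin (n + 1) → M) ↔ A.sat (Function.update e i x) b := by
  induction A with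
  | mem t u => simp [Fm.abst, Tm.val_abst]
  | eq t u => simp [Fm.abst, Tm.val_abst]
  | disj A B ihA ihB => simp [Fm.abst, ihA, ihB]
  | neg A ih => simp [Fm.abst, ih]
  | ex A ih => simp [Fm.abst, ← ih, Fin.cons_snoc_eq_snoc_cons]

@[simp] theorem Fm.sat_exN (i : ℕ) (A : Fm 0) (b : Fin 0 → M) :
    (Fm.exN i A).sat e b ↔ ∃ x : M, A.sat (Function.update e i x) b := by
  simp only [Fm.exN, Fm.sat_ex, ← Fm.sat_abst]
  refine exists_congr fun x => ?_
  rw [show (Fin.cons x b : Fin 1 → M) = Fin.snoc b x from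
    funext fun k => by rw [Fin.fin_one_eq_zero k]; rfl]

@[simp] theorem Fm.sat_allN (i : ℕ) (A : Fm 0) (b : Fin 0 → M) :
    (Fm.allN i A).sat e b ↔ ∀ x : M, A.sat (Function.update e i x) b := by
  simp [Fm.allN]

theorem Tm.val_subst (i : ℕ) (x t : Tm n) :
    (t.subst i x).val e b = t.val (Function.update e i (x.val e b)) b := by
  induction t with
  | zero => rfl
  | var k =>
    by_cases h : i = k
    · subst h; simp [Tm.subst]
    · simp [Tm.subst, h, Function.update_of_ne (Ne.symm h)]
  | ind k => rfl
  | eats t u iht ihu => simp [Tm.subst, iht, ihu]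

theorem Fm.sat_subst (e : ℕ → M) (i : ℕ) {n : ℕ} (b : Fin n → M) (x : Tm n) (A : Fm n) :
    (A.subst i x).sat e b ↔ A.sat (Function.update e i (x.val e b)) b := by
  induction A with
  | mem t u => simp [Fm.subst, Tm.val_subst]
  | eq t u => simp [Fm.subst, Tm.val_subst]
  | disj A B ihA ihB => simp [Fm.subst, ihA, ihB]
  | neg A ih => simp [Fm.subst, ih]
  | ex A ih => simp [Fm.subst, ih]

theorem Tm.val_congr {e e' : ℕ → M} {t : Tm n} (h : ∀ i ∈ t.fv, e i = e' i) :
    t.val e b = t.val e' b := by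
  induction t with
  | zero => rfl
  | var k => exact h k (by simp [Tm.fv])
  | ind k => rfl
  | eats t u iht ihu =>
    simp only [Tm.fv, Finset.mem_union] at h
    simp [iht fun i hi => h i (.inl hi), ihu fun i hi => h i (.inr hi)]

theorem Fm.sat_congr {e e' : ℕ → M} {n : ℕ} (b : Fin n → M) {A : Fm n}
    (h : ∀ i ∈ A.fv, e i = e' i) : A.sat e b ↔ A.sat e' b := by
  induction A with
  | mem t u =>
    simp only [Fm.fv, Finset.mem_union] at h
    simp [t.val_congr b fun i hi => h i (.inl hi), u.val_congr b fun i hi => h i (.inr hi)]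
  | eq t u =>
    simp only [Fm.fv, Finset.mem_union] at h
    simp [t.val_congr b fun i hi => h i (.inl hi), u.val_congr b fun i hi => h i (.inr hi)]
  | disj A B ihA ihB =>
    simp only [Fm.fv, Finset.mem_union] at h
    simp [ihA b fun i hi => h i (.inl hi), ihB b fun i hi => h i (.inr hi)]
  | neg A ih => simp [ih b h]
  | ex A ih => simp [fun x => ih (Fin.cons x b) h]

theorem Fm.sat_update_of_notMem {i : ℕ} {A : Fm n} (hi : i ∉ A.fv) (x : M) :
    A.sat (Function.update e i x) b ↔ A.sat e b :=
  Fm.sat_congr b fun k hk => Function.update_of_ne (fun h : k = i => hi (h ▸ hk)) x e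

end Semantics

theorem Tm.val_eq_eval {n : ℕ} (e : ℕ → HFSet) (b : Fin n → HFSet) (t : Tm n) :
    t.val e b = t.eval e b := by
  induction t with
  | eats t u iht ihu => simp only [Tm.val, Tm.eval, iht, ihu]; rfl
  | _ => rfl

theorem Fm.sat_iff_eval (e : ℕ → HFSet) {n : ℕ} (b : Fin n → HFSet) (A : Fm n) :
    A.sat e b ↔ A.eval e b := by
  induction A with
  | mem t u => simp only [Fm.sat, Fm.eval, Tm.val_eq_eval]; rfl
  | eq t u => simp only [Fm.sat, Fm.eval, Tm.val_eq_eval]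
  | disj A B ihA ihB => simp [Fm.eval, ihA, ihB]
  | neg A ih => simp [Fm.eval, ih]
  | ex A ih => simp [Fm.eval, ih]

/-! ## Soundness -/

/-- By ∈-induction all members of `x` satisfy `P`; as `x` is finite, it arises from the empty set by
adjoining these members one at a time. -/
theorem eats_induction {P : HFSet → Prop} (h0 : P HFSet.empty)
    (h : ∀ x y, P x → P y → P (HFSet.eats x y)) (x : HFSet) : P x := by
  classical
  have key : ∀ s : Finset HFSet, (∀ y ∈ s, P y) → ∀ x : HFSet, (∀ y, y ∈ x ↔ y ∈ s) → P x := by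
    intro s
    induction s using Finset.induction_on with
    | empty =>
      intro _ x hx
      rwa [HFSet.ext (x := x) (y := HFSet.empty) fun z => by simp [hx, HFSet.not_mem_empty]]
    | insert a s _ ih =>
      intro hs x hx
      obtain ⟨x', hx'⟩ := HFSet.exists_of_finset s
      rw [HFSet.ext (x := x) (y := HFSet.eats x' a) fun z => by
        rw [HFSet.mem_eats, hx, hx', Finset.mem_insert, or_comm]]
      exact h _ _ (ih (fun y hy => hs y (Finset.mem_insert_of_mem hy)) x' hx')
        (hs a (Finset.mem_insert_self a s))
  induction x using HFSet.mem_wf.induction with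
  | _ x ih =>
    exact key (HFSet.finite_mem x).toFinset (fun y hy => ih y (by simpa using hy)) x (by simp)

theorem InductionAx.sat {A : Fm 0} (h : InductionAx A) (e : ℕ → HFSet) (b : Fin 0 → HFSet) :
    A.sat e b := by
  obtain ⟨A, i, j, hij, hj⟩ := h
  simp only [Fm.sat_imp, Fm.sat_subst, Fm.sat_allN, Tm.val_zero, Tm.val_eats, Tm.val_var]
  intro h0 hs x
  refine eats_induction (P := fun x => A.sat (Function.update e i x) b) h0 ?_ x
  intro x y hx hy
  have := hs x y
  simp only [Function.update_self, Function.update_of_ne hij.symm] at this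
  -- Moving the change at `j` outermost allows it to be dropped, since `j` is not free in `A`.
  have comm : ∀ z, Function.update (Function.update (Function.update e i x) j y) i z =
      Function.update (Function.update e i z) j y := by
    intro z
    rw [Function.update_comm hij.symm, Function.update_idem, Function.update_comm hij.symm]
  rw [comm, comm, Fm.sat_update_of_notMem _ _ hj, Fm.sat_update_of_notMem _ _ hj,
    Fm.sat_update_of_notMem _ _ hj] at this
  exact this hx hy

/-- The induction ranges over all assignments because the ∃-rule evaluates its premise at a changed
value of the bound variable; the hypotheses do not contain that variable and stay true. -/
theorem HFThm.sound {E : Fm 0} (hE : ∀ e : ℕ → HFSet, E.Holds e) {H : Set (Fm 0)} {A : Fm 0}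
    (h : HFThm E H A) (e : ℕ → HFSet) (b : Fin 0 → HFSet) (hH : ∀ C ∈ H, C.sat e b) :
    A.sat e b := by
  induction h generalizing e with
  | hyp h => exact hH _ h
  | extra =>
    rw [Fm.sat_iff_eval, Subsingleton.elim b Fin.elim0]
    exact hE e
  | bool h =>
    cases h <;> simp only [Fm.sat_imp, Fm.sat_disj, Fm.sat_neg] <;> tauto
  | eq h =>
    rcases h with rfl | rfl | rfl | rfl <;>
      simp +contextual [reflAx, eqCongAx, memCongAx, eatsCongAx]
  | spec h =>
    obtain ⟨A, i, x⟩ := h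
    simp only [Fm.sat_imp, Fm.sat_subst, Fm.sat_exN]
    exact fun h => ⟨_, h⟩
  | hf h =>
    rcases h with rfl | rfl
    · simp only [hf1, Fm.sat_iff, Fm.sat_eq, Fm.sat_allN, Fm.sat_neg, Fm.sat_mem, Tm.val_var,
        Tm.val_zero]
      constructor
      · intro h x; simp [h]; exact HFSet.not_mem_empty x
      · intro h
        refine HFSet.ext fun z => ⟨fun hz => absurd ?_ (h z), fun hz => ?_⟩
        · rw [Function.update_self, Function.update_of_ne (by decide)]; exact hz
        · exact absurd hz (HFSet.not_mem_empty z)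
    · simp only [hf2, Fm.sat_iff, Fm.sat_eq, Fm.sat_allN, Fm.sat_disj, Fm.sat_mem, Tm.val_var,
        Tm.val_eats]
      have h0 : ∀ x : HFSet, Function.update e 3 x 0 = e 0 := fun x => rfl
      have h1 : ∀ x : HFSet, Function.update e 3 x 1 = e 1 := fun x => rfl
      have h2 : ∀ x : HFSet, Function.update e 3 x 2 = e 2 := fun x => rfl
      simp only [Function.update_self, h0, h1, h2]
      constructor
      · intro h x; rw [h]; exact HFSet.mem_eats _ _ _
      · exact fun h => HFSet.ext fun z => (h z).trans (HFSet.mem_eats _ _ _).symm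
  | ind h => exact h.sat e b
  | mp _ _ ih₁ ih₂ =>
    exact (Fm.sat_imp e b _ _).1 (ih₁ e fun C hC => hH C (.inl hC))
      (ih₂ e fun C hC => hH C (.inr hC))
  | _ _ hB hC ih =>
    rw [Fm.sat_imp, Fm.sat_exN]
    rintro ⟨x, hx⟩
    have := ih (Function.update e _ x) fun C h =>
      (Fm.sat_update_of_notMem e b (hC C h) x).2 (hH C h)
    rw [Fm.sat_imp, Fm.sat_update_of_notMem e b hB] at this
    exact this hx

/-! ## Propositional reasoning and the deduction theorem -/

namespace HFThm

variable {E : Fm 0} {H : Set (Fm 0)} {A B C : Fm 0}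

/-- There is no weakening rule, but `A IMP A` is an axiom over any hypotheses, and modus ponens with
it takes the union. -/
theorem weaken {H' : Set (Fm 0)} (h : HFThm E H A) (hH : H ⊆ H') : HFThm E H' A := by
  have := mp (bool (E := E) (H := H') (.ident A)) h
  rwa [Set.union_eq_self_of_subset_right hH] at this

theorem mp_same (h : HFThm E H (A IMP B)) (h' : HFThm E H A) : HFThm E H B := by
  simpa using mp h h'

/-- The axiom `disjConj` is resolution, and most of the propositional rules below come from it.
Commutativity, for instance, is a cut against the excluded middle `A IMP A`. -/
theorem cut (h : HFThm E H (C OR A)) (h' : HFThm E H (C.neg OR B)) : HFThm E H (A OR B) :=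
  mp_same (mp_same (bool (.disjConj A B C)) h) h'

theorem comm (h : HFThm E H (A OR B)) : HFThm E H (B OR A) :=
  cut h (bool (.ident A))

theorem inl (h : HFThm E H A) : HFThm E H (A OR B) := mp_same (bool (.disjI1 A B)) h

theorem inr (h : HFThm E H B) : HFThm E H (A OR B) := comm (inl h)

theorem cont (h : HFThm E H (A OR A)) : HFThm E H A := mp_same (bool (.disjCont A)) h

theorem assoc (h : HFThm E H (A OR (B OR C))) : HFThm E H ((A OR B) OR C) :=
  mp_same (bool (.disjAssoc A B C)) h

theorem assoc' (h : HFThm E H ((A OR B) OR C)) : HFThm E H (A OR (B OR C)) :=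
  comm (assoc (comm (assoc (comm h))))

theorem imp_intro (h : HFThm E H B) : HFThm E H (A IMP B) := inr h

theorem imp_trans (h : HFThm E H (A IMP B)) (h' : HFThm E H (B IMP C)) : HFThm E H (A IMP C) :=
  cut (comm h) h'

theorem imp_mp (h : HFThm E H (A IMP (B IMP C))) (h' : HFThm E H (A IMP B)) :
    HFThm E H (A IMP C) := by
  have h1 : HFThm E H (A.neg OR (C OR A.neg)) := cut (comm h') (assoc' (comm h))
  exact comm (cut (assoc (comm (assoc h1))) (bool (.disjCont A.neg)))

theorem imp_comm_disj : HFThm E H ((A OR B) IMP (B OR A)) :=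
  imp_mp (bool (.disjConj B A A)) (imp_intro (bool (.ident A)))

theorem imp_swap (h : HFThm E H (A IMP (B IMP C))) : HFThm E H (B IMP (A IMP C)) :=
  cut (assoc (comm (assoc h))) imp_comm_disj

theorem by_cases (h : HFThm E H (A IMP B)) (h' : HFThm E H (A.neg IMP B)) : HFThm E H B :=
  cont (cut h h')

theorem neg_of_imp_neg (h : HFThm E H (A IMP B.neg)) (h' : HFThm E H B) : HFThm E H A.neg :=
  cont (cut (inl h') (comm h))

theorem of_neg_imp_neg (h : HFThm E H (A.neg IMP B.neg)) (h' : HFThm E H B) : HFThm E H A :=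
  cont (cut (bool (.ident A)) (comm (cut (inl h') (comm h))))

/-- The delicate case is the ∃-rule. If `A` is a hypothesis, the bound variable is not free in it,
and the rule applies after swapping antecedents. If not, removing `A` changes nothing and the rule
applies as it stands, even when the variable is free in `A`. -/
theorem deduction (h : HFThm E H B) (A : Fm 0) : HFThm E (H \ {A}) (A IMP B) := by
  induction h with
  | @hyp H B hB =>
    by_cases hAB : B = A
    · subst hAB; exact bool (.ident B)
    · exact imp_intro (hyp ⟨hB, hAB⟩)
  | extra => exact imp_intro extra
  | bool h => exact imp_intro (bool h)
  | eq h => exact imp_intro (eq h)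
  | spec h => exact imp_intro (spec h)
  | hf h => exact imp_intro (hf h)
  | ind h => exact imp_intro (ind h)
  | mp _ _ ih₁ ih₂ =>
    exact imp_mp (ih₁.weaken (Set.sdiff_subset_sdiff_left Set.subset_union_left))
      (ih₂.weaken (Set.sdiff_subset_sdiff_left Set.subset_union_right))
  | _ h hY hH ih =>
    rename_i H X Y i
    by_cases hA : A ∈ H
    · refine imp_swap (HFThm.exists (imp_swap ih) ?_ fun C hC => hH C hC.1)
      simp only [Fm.imp, Fm.fv, Finset.mem_union, not_or]
      exact ⟨hH A hA, hY⟩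
    · rw [Set.sdiff_singleton_eq_self hA]
      exact imp_intro (HFThm.exists h hY hH)

theorem deduction_insert (h : HFThm E (insert A H) B) : HFThm E H (A IMP B) :=
  (h.deduction A).weaken (by simp)

/-- Finiteness of proofs lets unprovability of a fixed formula pass to unions of chains, both for
the witnesses and for Zorn's lemma. -/
theorem exists_finite (h : HFThm E H A) : ∃ F ⊆ H, F.Finite ∧ HFThm E F A := by
  induction h with
  | @hyp H B hB =>
    exact ⟨{B}, Set.singleton_subset_iff.2 hB, Set.finite_singleton B, hyp rfl⟩
  | extra => exact ⟨∅, Set.empty_subset _, Set.finite_empty, extra⟩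
  | bool h => exact ⟨∅, Set.empty_subset _, Set.finite_empty, bool h⟩
  | eq h => exact ⟨∅, Set.empty_subset _, Set.finite_empty, eq h⟩
  | spec h => exact ⟨∅, Set.empty_subset _, Set.finite_empty, spec h⟩
  | hf h => exact ⟨∅, Set.empty_subset _, Set.finite_empty, hf h⟩
  | ind h => exact ⟨∅, Set.empty_subset _, Set.finite_empty, ind h⟩
  | mp _ _ ih₁ ih₂ =>
    obtain ⟨F₁, hF₁, hf₁, h₁⟩ := ih₁
    obtain ⟨F₂, hF₂, hf₂, h₂⟩ := ih₂
    exact ⟨F₁ ∪ F₂, Set.union_subset_union hF₁ hF₂, hf₁.union hf₂, mp h₁ h₂⟩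
  | _ _ hB hH ih =>
    obtain ⟨F, hF, hf, h⟩ := ih
    exact ⟨F, hF, hf, HFThm.exists h hB fun C hC => hH C (hF hC)⟩

/-- The admissible rule of substitution. -/
theorem subst (h : HFThm E ∅ A) (i : ℕ) (t : Tm 0) : HFThm E ∅ (A.subst i t) := by
  -- `fls IMP fls` is a closed theorem, so its negation is a refutable conclusion to which the
  -- ∃-rule applies for any variable. This refutes `∃ i. ¬A`, hence `¬A(t)` by the quantifier axiom.
  have h1 : HFThm E ∅ (A.neg IMP (Fm.fls IMP Fm.fls).neg) :=
    inl (neg_of_imp_neg (bool (.ident A.neg)) h)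
  have h2 : HFThm E ∅ (Fm.exN i A.neg IMP (Fm.fls IMP Fm.fls).neg) :=
    HFThm.exists h1 (by simp [Fm.imp, Fm.fls, Fm.fv, Tm.fv]) (by simp)
  exact of_neg_imp_neg (imp_trans (spec (.intro A.neg i t)) h2) (bool (.ident _))

end HFThm

/-! ## Instantiation of indices -/

/-- Simultaneous instantiation of the indices of a term. -/
def Tm.inst {n m : ℕ} (σ : Fin n → Tm m) : Tm n → Tm m
  | .zero => .zero
  | .var i => .var i
  | .ind k => σ k
  | .eats t u => .eats (t.inst σ) (u.inst σ)

/-- The instantiation `σ` below one more quantifier. -/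
def upInst {n m : ℕ} (σ : Fin n → Tm m) : Fin (n + 1) → Tm (m + 1) :=
  Fin.cons (.ind 0) fun k => (σ k).lift

/-- Simultaneous instantiation of the indices of a formula. -/
def Fm.inst : {n : ℕ} → Fm n → {m : ℕ} → (Fin n → Tm m) → Fm m
  | _, .mem t u, _, σ => .mem (t.inst σ) (u.inst σ)
  | _, .eq t u, _, σ => .eq (t.inst σ) (u.inst σ)
  | _, .disj A B, _, σ => .disj (A.inst σ) (B.inst σ)
  | _, .neg A, _, σ => .neg (A.inst σ)
  | _, .ex A, _, σ => .ex (A.inst (upInst σ))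

theorem Tm.inst_lift {n m : ℕ} (σ : Fin (n + 1) → Tm m) (t : Tm n) :
    t.lift.inst σ = t.inst fun k => σ k.succ := by
  induction t <;> simp_all [Tm.lift, Tm.inst]

theorem Tm.lift_inst {n m : ℕ} (σ : Fin n → Tm m) (t : Tm n) :
    (t.inst σ).lift = t.inst fun k => (σ k).lift := by
  induction t <;> simp_all [Tm.lift, Tm.inst]

theorem Tm.inst_inst {n m l : ℕ} (σ : Fin n → Tm m) (τ : Fin m → Tm l) (t : Tm n) :
    (t.inst σ).inst τ = t.inst fun k => (σ k).inst τ := by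
  induction t <;> simp_all [Tm.inst]

theorem upInst_inst {n m l : ℕ} (σ : Fin n → Tm m) (τ : Fin m → Tm l) :
    (fun k => (upInst σ k).inst (upInst τ)) = upInst fun k => (σ k).inst τ := by
  funext k
  refine Fin.cases rfl (fun k => ?_) k
  simp [upInst, Tm.inst_lift, Tm.lift_inst]

theorem Fm.inst_inst {n : ℕ} (A : Fm n) {m l : ℕ} (σ : Fin n → Tm m) (τ : Fin m → Tm l) :
    (A.inst σ).inst τ = A.inst fun k => (σ k).inst τ := by
  induction A generalizing m l with
  | mem t u => simp [Fm.inst, Tm.inst_inst]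
  | eq t u => simp [Fm.inst, Tm.inst_inst]
  | disj A B ihA ihB => simp [Fm.inst, ihA, ihB]
  | neg A ih => simp [Fm.inst, ih]
  | ex A ih => simp [Fm.inst, ih, upInst_inst]

theorem Tm.inst_ind {n : ℕ} (t : Tm n) : t.inst Tm.ind = t := by
  induction t <;> simp_all [Tm.inst]

theorem Fm.inst_ind {n : ℕ} (A : Fm n) : A.inst Tm.ind = A := by
  induction A with
  | mem t u => simp [Fm.inst, Tm.inst_ind]
  | eq t u => simp [Fm.inst, Tm.inst_ind]
  | disj A B ihA ihB => simp [Fm.inst, ihA, ihB]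
  | neg A ih => simp [Fm.inst, ih]
  | @ex n A ih =>
    have : upInst (Tm.ind (n := n)) = Tm.ind :=
      funext fun k => Fin.cases rfl (fun k => by simp [upInst, Tm.lift]) k
    simp [Fm.inst, this, ih]

theorem Tm.lift_abst {n : ℕ} (i : ℕ) (t : Tm n) : t.lift.abst i = (t.abst i).lift := by
  induction t with
  | var k => by_cases h : i = k <;> simp [Tm.lift, Tm.abst, h]
  | _ => simp_all [Tm.lift, Tm.abst]

theorem Tm.lift_subst {n : ℕ} (i : ℕ) (x t : Tm n) :
    t.lift.subst i x.lift = (t.subst i x).lift := by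
  induction t with
  | var k => by_cases h : i = k <;> simp [Tm.lift, Tm.subst, h]
  | _ => simp_all [Tm.lift, Tm.subst]

theorem Tm.abst_inst {n m : ℕ} {i : ℕ} (σ : Fin n → Tm m) {t : Tm n} (h : i ∉ t.fv) :
    (t.inst σ).abst i = t.inst fun k => (σ k).abst i := by
  induction t with
  | var k =>
    have : i ≠ k := by simpa [Tm.fv] using h
    simp [Tm.inst, Tm.abst, this]
  | _ => simp_all [Tm.inst, Tm.abst, Tm.fv]

theorem upInst_abst {n m : ℕ} (i : ℕ) (σ : Fin n → Tm m) :
    (fun k => (upInst σ k).abst i) = upInst fun k => (σ k).abst i := by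
  funext k
  refine Fin.cases rfl (fun k => ?_) k
  simp [upInst, Tm.lift_abst]

theorem Fm.abst_inst {n : ℕ} {i : ℕ} {A : Fm n} (h : i ∉ A.fv) {m : ℕ} (σ : Fin n → Tm m) :
    (A.inst σ).abst i = A.inst fun k => (σ k).abst i := by
  induction A generalizing m with
  | ex A ih => simp only [Fm.inst, Fm.abst, ih h, upInst_abst]
  | _ => simp_all [Fm.inst, Fm.abst, Fm.fv, Tm.abst_inst]

theorem Tm.subst_inst {n m : ℕ} {i : ℕ} (x : Tm m) (σ : Fin n → Tm m) {t : Tm n} (h : i ∉ t.fv) :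
    (t.inst σ).subst i x = t.inst fun k => (σ k).subst i x := by
  induction t with
  | var k =>
    have : i ≠ k := by simpa [Tm.fv] using h
    simp [Tm.inst, Tm.subst, this]
  | _ => simp_all [Tm.inst, Tm.subst, Tm.fv]

theorem upInst_subst {n m : ℕ} (i : ℕ) (x : Tm m) (σ : Fin n → Tm m) :
    (fun k => (upInst σ k).subst i x.lift) = upInst fun k => (σ k).subst i x := by
  funext k
  refine Fin.cases rfl (fun k => ?_) k
  simp [upInst, Tm.lift_subst]

theorem Fm.subst_inst {n : ℕ} {i : ℕ} {A : Fm n} (h : i ∉ A.fv) {m : ℕ} (x : Tm m)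
    (σ : Fin n → Tm m) : (A.inst σ).subst i x = A.inst fun k => (σ k).subst i x := by
  induction A generalizing m with
  | ex A ih => simp only [Fm.inst, Fm.subst, ih h, upInst_subst]
  | _ => simp_all [Fm.inst, Fm.subst, Fm.fv, Tm.subst_inst]

/-- The bridge from named to nameless quantification: the rules, stated for `exN i A`, apply through
a fresh variable to every `B.ex`. -/
theorem Fm.abst_inst_var {i : ℕ} {B : Fm 1} (h : i ∉ B.fv) :
    (B.inst fun _ => (.var i : Tm 0)).abst i = B := by
  rw [Fm.abst_inst h]
  convert B.inst_ind
  rename_i k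
  simp [Tm.abst, Fin.fin_one_eq_zero k]

theorem Tm.subst_of_notMem {n : ℕ} {i : ℕ} {t : Tm n} (h : i ∉ t.fv) (x : Tm n) :
    t.subst i x = t := by
  induction t with
  | var k =>
    have : i ≠ k := by simpa [Tm.fv] using h
    simp [Tm.subst, this]
  | _ => simp_all [Tm.subst, Tm.fv]

theorem exists_fresh (s : Finset ℕ) : ∃ i, i ∉ s := Infinite.exists_notMem_finset s

namespace HFThm

variable {E : Fm 0} {H : Set (Fm 0)} {A C : Fm 0}

theorem ex_intro (B : Fm 1) (t : Tm 0) : HFThm E H (B.inst (fun _ => t) IMP B.ex) := by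
  obtain ⟨i, hi⟩ := exists_fresh B.fv
  have := spec (E := E) (H := H) (.intro (B.inst fun _ => (.var i : Tm 0)) i t)
  rw [Fm.subst_inst hi, Fm.exN, Fm.abst_inst_var hi] at this
  simpa [Tm.subst] using this

theorem ex_elim {B : Fm 1} {i : ℕ} (h : HFThm E H (B.inst (fun _ => (.var i : Tm 0)) IMP C))
    (hB : i ∉ B.fv) (hC : i ∉ C.fv) (hH : ∀ D ∈ H, i ∉ D.fv) : HFThm E H (B.ex IMP C) := by
  have := HFThm.exists h hC hH
  rwa [Fm.exN, Fm.abst_inst_var hB] at this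

/-! ## Equality -/

/-- The equality axioms concern the variables 1 to 4, and successive substitutions could alter terms
already inserted. Renaming first to variables above `N`, which bounds 4 and all variables of the
four terms, makes them act as a simultaneous one. -/
theorem subst_four {F : Tm 0 → Tm 0 → Tm 0 → Tm 0 → Fm 0}
    (hF : ∀ i x a b c d,
      (F a b c d).subst i x = F (a.subst i x) (b.subst i x) (c.subst i x) (d.subst i x))
    (h : HFThm E ∅ (F (.var 1) (.var 2) (.var 3) (.var 4))) (t₁ t₂ t₃ t₄ : Tm 0) :
    HFThm E ∅ (F t₁ t₂ t₃ t₄) := by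
  obtain ⟨N, hN⟩ : ∃ N, ∀ i ∈ t₁.fv ∪ t₂.fv ∪ t₃.fv ∪ t₄.fv ∪ {4}, i < N :=
    ⟨_, fun i hi => Nat.lt_succ_of_le (Finset.le_sup (f := id) hi)⟩
  have h4 : 4 < N := hN 4 (by simp)
  have hf : ∀ t ∈ [t₁, t₂, t₃, t₄], ∀ k, N + k ∉ t.fv := by
    intro t ht k hk
    have := hN (N + k) (by simp at ht; rcases ht with rfl | rfl | rfl | rfl <;> simp [hk])
    omega
  have := ((((((((h.subst 1 (.var (N + 1))).subst 2 (.var (N + 2))).subst 3 (.var (N + 3))).subst 4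
    (.var (N + 4))).subst (N + 1) t₁).subst (N + 2) t₂).subst (N + 3) t₃).subst (N + 4) t₄)
  have e1 : ∀ k, 1 ≠ N + k := by omega
  have e2 : ∀ k, 2 ≠ N + k := by omega
  have e3 : ∀ k, 3 ≠ N + k := by omega
  have e4 : ∀ k, 4 ≠ N + k := by omega
  simp only [hF] at this
  simpa [Tm.subst, e1, e2, e3, e4, Tm.subst_of_notMem (hf t₁ (by simp) _),
    Tm.subst_of_notMem (hf t₂ (by simp) _), Tm.subst_of_notMem (hf t₃ (by simp) _),
    Tm.subst_of_notMem (hf t₄ (by simp) _)] using this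

theorem eq_refl (t : Tm 0) : HFThm E ∅ (t EQ t) := by
  exact (eq (E := E) (H := ∅) (.inl rfl)).subst 1 t

theorem eq_cong (t₁ t₂ t₃ t₄ : Tm 0) :
    HFThm E ∅ ((t₁ EQ t₂ AND t₃ EQ t₄) IMP (t₁ EQ t₃ IMP t₂ EQ t₄)) :=
  subst_four (F := fun t₁ t₂ t₃ t₄ => (t₁ EQ t₂ AND t₃ EQ t₄) IMP (t₁ EQ t₃ IMP t₂ EQ t₄))
    (fun _ _ _ _ _ _ => rfl) (eq (.inr (.inl rfl))) _ _ _ _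

theorem mem_cong (t₁ t₂ t₃ t₄ : Tm 0) :
    HFThm E ∅ ((t₁ EQ t₂ AND t₃ EQ t₄) IMP (t₁ IN t₃ IMP t₂ IN t₄)) :=
  subst_four (F := fun t₁ t₂ t₃ t₄ => (t₁ EQ t₂ AND t₃ EQ t₄) IMP (t₁ IN t₃ IMP t₂ IN t₄))
    (fun _ _ _ _ _ _ => rfl) (eq (.inr (.inr (.inl rfl)))) _ _ _ _

theorem eats_cong (t₁ t₂ t₃ t₄ : Tm 0) :
    HFThm E ∅ ((t₁ EQ t₂ AND t₃ EQ t₄) IMP (.eats t₁ t₃ EQ .eats t₂ t₄)) :=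
  subst_four (F := fun t₁ t₂ t₃ t₄ => (t₁ EQ t₂ AND t₃ EQ t₄) IMP (.eats t₁ t₃ EQ .eats t₂ t₄))
    (fun _ _ _ _ _ _ => rfl) (eq (.inr (.inr (.inr rfl)))) _ _ _ _

theorem generalize (h : HFThm E ∅ A) (i : ℕ) : HFThm E ∅ (.allN i A) := by
  have h1 : HFThm E ∅ (A.neg IMP (Fm.fls IMP Fm.fls).neg) :=
    inl (neg_of_imp_neg (bool (.ident A.neg)) h)
  exact neg_of_imp_neg (HFThm.exists h1 (by simp [Fm.imp, Fm.fls, Fm.fv, Tm.fv]) (by simp))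
    (bool (.ident _))

end HFThm

/-! ## Completeness -/

/-- A deductively closed set of formulas that is complete and has witnesses. -/
structure IsHenkin (E : Fm 0) (Γ : Set (Fm 0)) : Prop where
  neg_iff : ∀ A, HFThm E Γ A.neg ↔ ¬ HFThm E Γ A
  disj_iff : ∀ A B, HFThm E Γ (A OR B) ↔ HFThm E Γ A ∨ HFThm E Γ B
  ex_iff : ∀ B : Fm 1, HFThm E Γ B.ex ↔ ∃ t : Tm 0, HFThm E Γ (B.inst fun _ => t)

/-- The Henkin axiom for `B`, with a fresh variable, is conservative. -/
theorem HFThm.of_henkin_witness {E : Fm 0} {H : Set (Fm 0)} {G : Fm 0} {B : Fm 1} {i : ℕ}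
    (h : HFThm E (insert (B.ex IMP B.inst fun _ => (.var i : Tm 0)) H) G)
    (hB : i ∉ B.fv) (hG : i ∉ G.fv) (hH : ∀ D ∈ H, i ∉ D.fv) : HFThm E H G := by
  have h1 := h.deduction_insert
  -- The Henkin axiom follows from `¬∃B` vacuously and from the instance of `B`. So `G` follows from
  -- either; in the second case the fresh variable can be quantified.
  have h2 : HFThm E H (B.ex.neg IMP G) :=
    imp_trans (.bool (.disjI1 _ _)) h1
  have h3 : HFThm E H ((B.inst fun _ => (.var i : Tm 0)) IMP G) :=
    imp_trans (imp_trans (bool (.disjI1 _ _)) imp_comm_disj) h1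
  exact by_cases (ex_elim h3 hB hG hH) h2

/-- Ordinary variables serve as witnesses, without new constants: along an enumeration of `Fm 1`
each stage is finite, so some variable is free neither in it, nor in `G`, nor in the formula at
hand. Countability is supplied later by the injectivity of coding. -/
theorem exists_witnesses [Countable (Fm 1)] (E G : Fm 0) (hG : ¬ HFThm E ∅ G) :
    ∃ W : Set (Fm 0), ¬ HFThm E W G ∧
      ∀ B : Fm 1, ∃ t : Tm 0, (B.ex IMP B.inst fun _ => t) ∈ W := by
  classical
  have : Nonempty (Fm 1) := ⟨.mem .zero .zero⟩
  obtain ⟨β, hβ⟩ := exists_surjective_nat (Fm 1)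
  choose fresh hfresh using exists_fresh
  let v (n : ℕ) (S : Finset (Fm 0)) : ℕ := fresh ((β n).fv ∪ G.fv ∪ S.biUnion Fm.fv)
  let F : ℕ → Finset (Fm 0) := fun n => Nat.rec (motive := fun _ => Finset (Fm 0)) ∅
    (fun n S => insert ((β n).ex IMP (β n).inst fun _ => (.var (v n S) : Tm 0)) S) n
  have hF : ∀ n, F (n + 1) =
    insert ((β n).ex IMP (β n).inst fun _ => (.var (v n (F n)) : Tm 0)) (F n) := fun n => rfl
  have hmono : Monotone F := monotone_nat_of_le_succ fun n => by
    rw [hF]; exact Finset.subset_insert _ _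
  have hcons : ∀ n, ¬ HFThm E (F n : Set (Fm 0)) G := by
    intro n
    induction n with
    | zero => simpa [F] using hG
    | succ n ih =>
      intro h
      have hv := hfresh ((β n).fv ∪ G.fv ∪ (F n).biUnion Fm.fv)
      simp only [Finset.mem_union, not_or, Finset.mem_biUnion, not_exists, not_and] at hv
      rw [hF, Finset.coe_insert] at h
      exact ih (h.of_henkin_witness hv.1.1 hv.1.2 fun D hD => hv.2 D hD)
  refine ⟨⋃ n, (F n : Set (Fm 0)), fun h => ?_, fun B => ?_⟩
  · obtain ⟨S, hS, hfin, h⟩ := h.exists_finite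
    obtain ⟨n, hn⟩ := Directed.exists_mem_subset_of_finset_subset_biUnion
      (f := fun n => (F n : Set (Fm 0)))
      (Monotone.directed_le fun m n h => Finset.coe_subset.2 (hmono h)) (s := hfin.toFinset)
      (by simpa using hS)
    exact hcons n (h.weaken (by simpa using hn))
  · obtain ⟨n, rfl⟩ := hβ B
    exact ⟨.var (v n (F n)), Set.mem_iUnion.2 ⟨n + 1, by rw [hF]; simp⟩⟩

/-- Maximality is among the sets that do not prove `G`. An unprovable `A` then has `A IMP G`
provable, so if `A` and `¬A` were both unprovable, `G` would follow by cases. This completeness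
gives the Boolean clauses; the Henkin axioms in `W` give the quantifier clause. -/
theorem exists_isHenkin [Countable (Fm 1)] (E G : Fm 0) (hG : ¬ HFThm E ∅ G) :
    ∃ Γ : Set (Fm 0), ¬ HFThm E Γ G ∧ IsHenkin E Γ := by
  obtain ⟨W, hW, hwit⟩ := exists_witnesses E G hG
  obtain ⟨Γ, hWΓ, hΓ⟩ := zorn_subset_nonempty {Γ : Set (Fm 0) | ¬ HFThm E Γ G} (by
    intro c hc hchain hne
    refine ⟨⋃₀ c, fun h => ?_, fun s hs => Set.subset_sUnion_of_mem hs⟩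
    obtain ⟨S, hS, hfin, h⟩ := h.exists_finite
    obtain ⟨T, hT, hST⟩ := hchain.directedOn.exists_mem_subset_of_finite_of_subset_sUnion
      hne hfin hS
    exact hc hT (h.weaken hST)) W hW
  have hG' : ¬ HFThm E Γ G := hΓ.prop
  have hmax : ∀ A, ¬ HFThm E Γ A → HFThm E Γ (A IMP G) := by
    intro A hA
    by_contra hcon
    have : insert A Γ ⊆ Γ := hΓ.le_of_ge (y := insert A Γ)
      (fun h => hcon h.deduction_insert) (Set.subset_insert _ _)
    exact hA (.hyp (this (Set.mem_insert A Γ)))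
  have hneg : ∀ A, HFThm E Γ A.neg ↔ ¬ HFThm E Γ A := by
    intro A
    constructor
    · exact fun h h' => hG' (.cont (.cut (.inl h') (.inl h)))
    · intro h
      by_contra h'
      exact hG' (.by_cases (hmax _ h) (hmax _ h'))
  have hdisj : ∀ A B, HFThm E Γ (A OR B) ↔ HFThm E Γ A ∨ HFThm E Γ B := by
    intro A B
    constructor
    · intro h
      by_cases hA : HFThm E Γ A
      · exact .inl hA
      · exact .inr (.cont (.cut h (.inl ((hneg A).2 hA))))
    · rintro (h | h)
      exacts [.inl h, .inr h]
  refine ⟨Γ, hG', hneg, hdisj, fun B => ⟨fun h => ?_, fun ⟨t, h⟩ => .mp_same (.ex_intro B t) h⟩⟩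
  obtain ⟨t, ht⟩ := hwit B
  exact ⟨t, .mp_same (.hyp (hWΓ ht)) h⟩

namespace IsHenkin

variable {E : Fm 0} {Γ : Set (Fm 0)}

theorem conj_mp (hΓ : IsHenkin E Γ) {A B C : Fm 0} (h : HFThm E ∅ ((A AND B) IMP C))
    (hA : HFThm E Γ A) (hB : HFThm E Γ B) : HFThm E Γ C := by
  refine .mp_same (h.weaken (Set.empty_subset _)) ?_
  rw [Fm.conj, hΓ.neg_iff, hΓ.disj_iff, hΓ.neg_iff, hΓ.neg_iff]
  tauto

theorem eq_refl (t : Tm 0) : HFThm E Γ (t EQ t) :=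
  (HFThm.eq_refl t).weaken (Set.empty_subset _)

theorem eq_symm (hΓ : IsHenkin E Γ) {t u : Tm 0} (h : HFThm E Γ (t EQ u)) : HFThm E Γ (u EQ t) :=
  (hΓ.conj_mp (.eq_cong t u t t) h (eq_refl t)).mp_same (eq_refl t)

theorem eq_trans (hΓ : IsHenkin E Γ) {t u v : Tm 0} (h : HFThm E Γ (t EQ u))
    (h' : HFThm E Γ (u EQ v)) : HFThm E Γ (t EQ v) :=
  (hΓ.conj_mp (.eq_cong t t u v) (eq_refl t) h').mp_same h

/-- Provable equality of terms. -/
def setoid (hΓ : IsHenkin E Γ) : Setoid (Tm 0) where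
  r t u := HFThm E Γ (t EQ u)
  iseqv := ⟨eq_refl, hΓ.eq_symm, hΓ.eq_trans⟩

/-- The term model of a Henkin set. -/
def Model (hΓ : IsHenkin E Γ) : Type := Quotient hΓ.setoid

/-- The class of a term in the term model. -/
def cls (hΓ : IsHenkin E Γ) (t : Tm 0) : hΓ.Model := Quotient.mk hΓ.setoid t

theorem cls_eq_cls (hΓ : IsHenkin E Γ) {t u : Tm 0} :
    hΓ.cls t = hΓ.cls u ↔ HFThm E Γ (t EQ u) :=
  Quotient.eq (r := hΓ.setoid)

instance (hΓ : IsHenkin E Γ) : HFStruct hΓ.Model where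
  zero := hΓ.cls .zero
  eats := Quotient.map₂ Tm.eats fun _ _ h _ _ h' => hΓ.conj_mp (.eats_cong _ _ _ _) h h'
  mem := Quotient.lift₂ (fun t u => HFThm E Γ (t IN u)) fun _ _ _ _ h h' => propext
    ⟨.mp_same (hΓ.conj_mp (.mem_cong _ _ _ _) h h'),
      .mp_same (hΓ.conj_mp (.mem_cong _ _ _ _) (hΓ.eq_symm h) (hΓ.eq_symm h'))⟩

theorem val_cls (hΓ : IsHenkin E Γ) {n : ℕ} (σ : Fin n → Tm 0) (t : Tm n) :
    t.val (fun i => hΓ.cls (.var i)) (fun k => hΓ.cls (σ k)) = hΓ.cls (t.inst σ) := by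
  induction t with
  | eats t u iht ihu => rw [Tm.val_eats, iht, ihu]; rfl
  | _ => rfl

theorem upInst_inst_const {n : ℕ} (σ : Fin n → Tm 0) (t : Tm 0) :
    (fun k => (upInst σ k).inst fun _ => t) = Fin.cons t σ := by
  funext k
  refine Fin.cases rfl (fun k => ?_) k
  simp only [upInst, Fin.cons_succ, Tm.inst_lift]
  exact (congrArg (fun τ => (σ k).inst τ) (Subsingleton.elim _ _)).trans (σ k).inst_ind

/-- The truth lemma, with every variable denoting its own class. In the quantifier case each element
of the model is the class of a term, so the witness clause of `IsHenkin` applies. -/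
theorem sat_iff (hΓ : IsHenkin E Γ) {n : ℕ} (σ : Fin n → Tm 0) (A : Fm n) :
    A.sat (fun i => hΓ.cls (.var i)) (fun k => hΓ.cls (σ k)) ↔ HFThm E Γ (A.inst σ) := by
  induction A with
  | mem t u => rw [Fm.sat_mem, hΓ.val_cls, hΓ.val_cls]; rfl
  | eq t u => rw [Fm.sat_eq, hΓ.val_cls, hΓ.val_cls, hΓ.cls_eq_cls]; rfl
  | disj A B ihA ihB => rw [Fm.sat_disj, ihA, ihB, ← hΓ.disj_iff]; rfl
  | neg A ih => rw [Fm.sat_neg, ih, ← hΓ.neg_iff]; rfl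
  | ex A ih =>
    rw [Fm.sat_ex, Fm.inst, hΓ.ex_iff]
    have key : ∀ t, (Fin.cons (hΓ.cls t) fun k => hΓ.cls (σ k) : Fin _ → hΓ.Model) =
        fun k => hΓ.cls ((Fin.cons t σ : Fin _ → Tm 0) k) := fun t =>
      funext fun k => Fin.cases rfl (fun k => rfl) k
    simp only [Fm.inst_inst, upInst_inst_const, ← ih, ← key]
    exact (Quotient.mk_surjective (s := hΓ.setoid)).exists

theorem sat_sentence_iff (hΓ : IsHenkin E Γ) (b : Fin 0 → hΓ.Model) (A : Fm 0) :
    A.sat (fun i => hΓ.cls (.var i)) b ↔ HFThm E Γ A := by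
  have := hΓ.sat_iff Tm.ind A
  rwa [Fm.inst_ind, Subsingleton.elim (fun k => hΓ.cls (.ind k)) b] at this

end IsHenkin

/-- A structure in which `0` is empty and `x ◁ y` is `x ∪ {y}`. -/
class HFModel (M : Type) extends HFStruct M where
  not_mem_zero (x : M) : ¬ mem x zero
  mem_eats_iff (u x y : M) : mem u (eats x y) ↔ mem u x ∨ u = y

theorem IsHenkin.sat_of_thm {E : Fm 0} {Γ : Set (Fm 0)} (hΓ : IsHenkin E Γ) {A : Fm 0}
    (h : HFThm E ∅ A) (b : Fin 0 → hΓ.Model) : A.sat (fun i => hΓ.cls (.var i)) b :=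
  (hΓ.sat_sentence_iff b A).2 (h.weaken (Set.empty_subset _))

/-- Only the left-to-right halves of HF1 and HF2, at `z = 0` and `z = x ◁ y`, are retained. The
fixed point needs neither extensionality nor induction in the model. -/
instance {E : Fm 0} {Γ : Set (Fm 0)} (hΓ : IsHenkin E Γ) : HFModel hΓ.Model where
  not_mem_zero x := by
    have := hΓ.sat_of_thm ((HFThm.hf (.inl rfl)).generalize 0) Fin.elim0
    rw [Fm.sat_allN] at this
    have := this HFStruct.zero
    simp only [hf1, Fm.sat_iff, Fm.sat_allN] at this
    exact this.1 rfl x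
  mem_eats_iff u x y := by
    have := hΓ.sat_of_thm ((((HFThm.hf (.inr rfl)).generalize 2).generalize 1).generalize 0)
      Fin.elim0
    simp only [Fm.sat_allN] at this
    have := this (HFStruct.eats x y) x y
    simp only [hf2, Fm.sat_iff, Fm.sat_allN] at this
    exact this.1 rfl u

/-- The completeness theorem. -/
theorem HFThm.complete [Countable (Fm 1)] (E A : Fm 0)
    (h : ∀ (M : Type) [HFModel M] (e : ℕ → M) (b : Fin 0 → M), A.sat e b) : HFThm E ∅ A := by
  by_contra hA
  obtain ⟨Γ, hΓA, hΓ⟩ := exists_isHenkin E A hA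
  exact hΓA ((hΓ.sat_sentence_iff Fin.elim0 A).1 (h _ _ _))

/-! ## Substitution in the provability predicate -/

section Subst

variable {n : ℕ} (i : ℕ) (x : Tm n)

@[simp] theorem subst_conj (A B : Fm n) :
    (A AND B).subst i x = (A.subst i x AND B.subst i x) := rfl
@[simp] theorem subst_imp (A B : Fm n) :
    (A IMP B).subst i x = (A.subst i x IMP B.subst i x) := rfl

attribute [local simp] Fm.subst Tm.subst Tm.lift_subst exB all2

@[simp] theorem subst_hpair (a b : Tm n) :
    (hpair a b).subst i x = hpair (a.subst i x) (b.subst i x) := rfl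
@[simp] theorem subst_ordOf (k : ℕ) : (ordOf k : Tm n).subst i x = ordOf k := by
  induction k with
  | zero => rfl
  | succ k ih => simp [ordOf, succ, ih]
@[simp] theorem subst_htuple (k : ℕ) : (htuple k : Tm n).subst i x = htuple k := by
  induction k with
  | zero => rfl
  | succ k ih => simp [htuple, ih]

@[simp] theorem subst_quot_tm {m : ℕ} (t : Tm m) : (t.quot : Tm n).subst i x = t.quot := by
  induction t <;> simp_all [Tm.quot, qInd, qEats]
@[simp] theorem subst_quot {m : ℕ} (A : Fm m) : (A.quot : Tm n).subst i x = A.quot := by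
  induction A <;> simp_all [Fm.quot, qMem, qEq, qDisj, qNeg, qEx]

attribute [local simp] qMem qEats qEq qDisj qNeg qEx qInd qImp qAll succ

variable (t u v w : Tm n)

@[simp] theorem subst_subsetP :
    (subsetP t u).subst i x = subsetP (t.subst i x) (u.subst i x) := by simp [subsetP]
@[simp] theorem subst_ordP : (ordP t).subst i x = ordP (t.subst i x) := by simp [ordP]
@[simp] theorem subst_functionP : (functionP t).subst i x = functionP (t.subst i x) := by
  simp [functionP]
@[simp] theorem subst_domainInclP :
    (domainInclP t u).subst i x = domainInclP (t.subst i x) (u.subst i x) := by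
  simp [domainInclP]
@[simp] theorem subst_lstSeqP :
    (lstSeqP t u v).subst i x = lstSeqP (t.subst i x) (u.subst i x) (v.subst i x) := by
  simp [lstSeqP]

attribute [local simp] derivP

@[simp] theorem subst_varP : (varP t).subst i x = varP (t.subst i x) := by simp [varP]
@[simp] theorem subst_indP : (indP t).subst i x = indP (t.subst i x) := by simp [indP]
@[simp] theorem subst_termP : (termP t).subst i x = termP (t.subst i x) := by simp [termP]
@[simp] theorem subst_stTermP : (stTermP t u v w).subst i x =
    stTermP (t.subst i x) (u.subst i x) (v.subst i x) (w.subst i x) := by simp [stTermP]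
@[simp] theorem subst_atomicP : (atomicP t).subst i x = atomicP (t.subst i x) := by
  simp [atomicP]
@[simp] theorem subst_stAtomicP : (stAtomicP t u v w).subst i x =
    stAtomicP (t.subst i x) (u.subst i x) (v.subst i x) (w.subst i x) := by simp [stAtomicP]
@[simp] theorem subst_abstFormP : (abstFormP t u v w).subst i x =
    abstFormP (t.subst i x) (u.subst i x) (v.subst i x) (w.subst i x) := by simp [abstFormP]
@[simp] theorem subst_substFormP : (substFormP t u v w).subst i x =
    substFormP (t.subst i x) (u.subst i x) (v.subst i x) (w.subst i x) := by simp [substFormP]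
@[simp] theorem subst_makeFormP : (makeFormP t u v).subst i x =
    makeFormP (t.subst i x) (u.subst i x) (v.subst i x) := by simp [makeFormP]
@[simp] theorem subst_formP : (formP t).subst i x = formP (t.subst i x) := by simp [formP]
@[simp] theorem subst_varNonOccFormP :
    (varNonOccFormP t u).subst i x = varNonOccFormP (t.subst i x) (u.subst i x) := by
  simp [varNonOccFormP]
@[simp] theorem subst_booleanAxP : (booleanAxP t).subst i x = booleanAxP (t.subst i x) := by
  simp [booleanAxP]
@[simp] theorem subst_equalityAxP : (equalityAxP t).subst i x = equalityAxP (t.subst i x) := by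
  simp [equalityAxP]
@[simp] theorem subst_hfAxP : (hfAxP t).subst i x = hfAxP (t.subst i x) := by simp [hfAxP]
@[simp] theorem subst_specialAxP : (specialAxP t).subst i x = specialAxP (t.subst i x) := by
  simp [specialAxP]
@[simp] theorem subst_inductionAxP :
    (inductionAxP t).subst i x = inductionAxP (t.subst i x) := by simp [inductionAxP]
@[simp] theorem subst_axiomP (E : Fm 0) : (axiomP E t).subst i x = axiomP E (t.subst i x) := by
  simp [axiomP]
@[simp] theorem subst_modPonP : (modPonP t u v).subst i x =
    modPonP (t.subst i x) (u.subst i x) (v.subst i x) := by simp [modPonP]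
@[simp] theorem subst_existsP : (existsP t u).subst i x =
    existsP (t.subst i x) (u.subst i x) := by simp [existsP]
@[simp] theorem subst_substP : (substP t u).subst i x =
    substP (t.subst i x) (u.subst i x) := by simp [substP]
-- This is used twice: to bound the free variables of `pfP` (`fv_pfP`), and to replace a variable
-- whose value is a code by the closed term for that code (`sat_pfP_var_iff`).
@[simp] theorem subst_pfP (E : Fm 0) : (pfP E t).subst i x = pfP E (t.subst i x) := by
  simp [pfP]

end Subst

/-! ## Codes as elements of a structure -/

namespace HFStruct

variable {M : Type} [HFStruct M]

/-- The ordered pair in a structure. -/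
def pair (a b : M) : M := eats (eats zero (eats (eats zero b) a)) (eats (eats zero a) a)

/-- The von Neumann numerals in a structure. -/
def ord : ℕ → M
  | 0 => zero
  | k + 1 => eats (ord k) (ord k)

/-- The tags of the syntactic constructors in a structure. -/
def tag : ℕ → M
  | 0 => pair zero zero
  | k + 1 => pair zero (tag k)

/-- The tagged pair that codes a term or formula built by `mem`. -/
def memCode (a b : M) : M := pair (tag 0) (pair a b)

/-- The tagged pair that codes a term or formula built by `eats`. -/
def eatsCode (a b : M) : M := pair (tag 1) (pair a b)

/-- The tagged pair that codes a term or formula built by `eq`. -/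
def eqCode (a b : M) : M := pair (tag 2) (pair a b)

/-- The tagged pair that codes a term or formula built by `disj`. -/
def disjCode (a b : M) : M := pair (tag 3) (pair a b)

/-- The tagged pair that codes a formula or index built by `neg`. -/
def negCode (a : M) : M := pair (tag 4) a

/-- The tagged pair that codes a formula or index built by `ex`. -/
def exCode (a : M) : M := pair (tag 5) a

/-- The tagged pair that codes a formula or index built by `ind`. -/
def indCode (a : M) : M := pair (tag 6) a

/-- The code of an implication. -/
def impCode (a b : M) : M := disjCode (negCode a) b

/-- The code of a universal quantification. -/
def allCode (a : M) : M := negCode (exCode (negCode a))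

end HFStruct

open HFStruct (pair ord tag memCode eatsCode eqCode disjCode negCode exCode indCode impCode
  allCode)

/-- The code of a term in a structure. -/
def Tm.code (M : Type) [HFStruct M] {n : ℕ} : Tm n → M
  | .zero => HFStruct.zero
  | .var i => ord (i + 1)
  | .ind k => indCode (ord k)
  | .eats t u => eatsCode (t.code M) (u.code M)

/-- The code of a formula in a structure. -/
def Fm.code (M : Type) [HFStruct M] : {n : ℕ} → Fm n → M
  | _, .mem t u => memCode (t.code M) (u.code M)
  | _, .eq t u => eqCode (t.code M) (u.code M)
  | _, .disj A B => disjCode (A.code M) (B.code M)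
  | _, .neg A => negCode (A.code M)
  | _, .ex A => exCode (A.code M)

section Val

variable {M : Type} [HFStruct M] {n : ℕ} (e : ℕ → M) (b : Fin n → M)

@[simp] theorem val_hpair (t u : Tm n) : (hpair t u).val e b = pair (t.val e b) (u.val e b) := rfl
@[simp] theorem val_succ (t : Tm n) :
    (succ t).val e b = HFStruct.eats (t.val e b) (t.val e b) := rfl
@[simp] theorem val_ordOf (k : ℕ) : (ordOf k : Tm n).val e b = ord k := by
  induction k with
  | zero => rfl
  | succ k ih => simp [ordOf, ord, ih]
@[simp] theorem val_htuple (k : ℕ) : (htuple k : Tm n).val e b = tag k := by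
  induction k with
  | zero => rfl
  | succ k ih => simp [htuple, tag, ih]

@[simp] theorem val_qMem (t u : Tm n) :
    (qMem t u).val e b = memCode (t.val e b) (u.val e b) := by simp [qMem, memCode]
@[simp] theorem val_qEats (t u : Tm n) :
    (qEats t u).val e b = eatsCode (t.val e b) (u.val e b) := by simp [qEats, eatsCode]
@[simp] theorem val_qEq (t u : Tm n) :
    (qEq t u).val e b = eqCode (t.val e b) (u.val e b) := by simp [qEq, eqCode]
@[simp] theorem val_qDisj (t u : Tm n) :
    (qDisj t u).val e b = disjCode (t.val e b) (u.val e b) := by simp [qDisj, disjCode]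
@[simp] theorem val_qNeg (t : Tm n) : (qNeg t).val e b = negCode (t.val e b) := by
  simp [qNeg, negCode]
@[simp] theorem val_qEx (t : Tm n) : (qEx t).val e b = exCode (t.val e b) := by
  simp [qEx, exCode]
@[simp] theorem val_qInd (t : Tm n) : (qInd t).val e b = indCode (t.val e b) := by
  simp [qInd, indCode]
@[simp] theorem val_qAll (t : Tm n) : (qAll t).val e b = allCode (t.val e b) := by
  simp [qAll, allCode]
@[simp] theorem val_qImp (t u : Tm n) :
    (qImp t u).val e b = impCode (t.val e b) (u.val e b) := by simp [qImp, impCode]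

@[simp] theorem Tm.val_quot {m : ℕ} (t : Tm m) : (t.quot : Tm n).val e b = t.code M := by
  induction t <;> simp_all [Tm.quot, Tm.code]

@[simp] theorem Fm.val_quot {m : ℕ} (A : Fm m) : (A.quot : Tm n).val e b = A.code M := by
  induction A <;> simp_all [Fm.quot, Fm.code]

end Val

/-! ## Pairs and numerals in models -/

namespace HFModel

variable {M : Type} [HFModel M]

theorem mem_pair_iff (u a b : M) : HFStruct.mem u (pair a b) ↔
    u = HFStruct.eats (HFStruct.eats HFStruct.zero b) a ∨
      u = HFStruct.eats (HFStruct.eats HFStruct.zero a) a := by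
  simp [pair, mem_eats_iff, not_mem_zero]

/-- Only the trivial half of extensionality is used: equal sets have the same members. -/
theorem pair_inj {a b c d : M} : pair a b = pair c d ↔ a = c ∧ b = d := by
  refine ⟨fun h => ?_, by rintro ⟨rfl, rfl⟩; rfl⟩
  have dbl : ∀ {a b c d : M}, HFStruct.eats (HFStruct.eats HFStruct.zero b) a =
      HFStruct.eats (HFStruct.eats HFStruct.zero d) c → ∀ u, u = b ∨ u = a ↔ u = d ∨ u = c := by
    intro a b c d h u
    have := mem_eats_iff u (HFStruct.eats HFStruct.zero b) a
    rw [h] at this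
    simpa [mem_eats_iff, not_mem_zero] using this.symm
  have hac : a = c := by
    have h1 : HFStruct.mem (HFStruct.eats (HFStruct.eats HFStruct.zero a) a) (pair c d) := by
      rw [← h]; simp [mem_pair_iff]
    rcases (mem_pair_iff _ _ _).1 h1 with h1 | h1
    · simpa using ((dbl h1 c).2 (.inr rfl)).symm.imp Eq.symm Eq.symm
    · simpa using ((dbl h1 c).2 (.inr rfl)).symm.imp Eq.symm Eq.symm
  subst hac
  refine ⟨rfl, ?_⟩
  have h1 : HFStruct.mem (HFStruct.eats (HFStruct.eats HFStruct.zero b) a) (pair a d) := by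
    rw [← h]; simp [mem_pair_iff]
  have h2 : HFStruct.mem (HFStruct.eats (HFStruct.eats HFStruct.zero d) a) (pair a b) := by
    rw [h]; simp [mem_pair_iff]
  rcases (mem_pair_iff _ _ _).1 h1 with h1 | h1 <;> rcases (mem_pair_iff _ _ _).1 h2 with h2 | h2 <;>
    have h3 := dbl h1 b <;> have h4 := dbl h2 d <;> simp at h3 h4 <;> grind

/-- This separates pairs from nonzero numerals, which all contain 0. -/
theorem not_zero_mem_pair (a b : M) : ¬ HFStruct.mem HFStruct.zero (pair a b) := by
  rw [mem_pair_iff]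
  have : ∀ x y : M, HFStruct.zero ≠ HFStruct.eats x y := fun x y h =>
    not_mem_zero y (h ▸ (mem_eats_iff y x y).2 (.inr rfl))
  simp [this]

theorem pair_ne_zero (a b : M) : pair a b ≠ HFStruct.zero := fun h =>
  not_mem_zero _ (h ▸ (mem_pair_iff _ a b).2 (.inr rfl))

/-- The induction is on the external number `k`, so standard numerals have only standard members
even in a nonstandard model. -/
theorem mem_ord_iff (u : M) (k : ℕ) : HFStruct.mem u (ord k) ↔ ∃ j < k, u = ord j := by
  induction k with
  | zero => simp [ord, not_mem_zero]
  | succ k ih =>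
    simp only [ord, mem_eats_iff, ih, Nat.lt_succ_iff_lt_or_eq]
    constructor
    · rintro (⟨j, hj, rfl⟩ | rfl)
      exacts [⟨j, .inl hj, rfl⟩, ⟨k, .inr rfl, rfl⟩]
    · rintro ⟨j, hj | rfl, rfl⟩
      exacts [.inl ⟨j, hj, rfl⟩, .inr rfl]

/-- Foundation may fail in the model. But a numeral that is a member of itself equals a smaller one
with the same property, which external induction excludes. -/
theorem ord_not_mem_self (k : ℕ) : ¬ HFStruct.mem (ord k : M) (ord k) := by
  induction k using Nat.strong_induction_on with
  | _ k ih =>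
    intro h
    obtain ⟨j, hj, hjk⟩ := (mem_ord_iff _ _).1 h
    exact ih j hj (by rw [← hjk]; exact h)

theorem ord_inj {j k : ℕ} : (ord j : M) = ord k ↔ j = k := by
  refine ⟨fun h => ?_, fun h => h ▸ rfl⟩
  rcases lt_trichotomy j k with hjk | hjk | hjk
  · exact absurd ((mem_ord_iff _ k).2 ⟨j, hjk, h.symm⟩) (ord_not_mem_self (M := M) k)
  · exact hjk
  · exact absurd ((mem_ord_iff _ j).2 ⟨k, hjk, h⟩) (ord_not_mem_self (M := M) j)

theorem zero_mem_ord_succ (k : ℕ) : HFStruct.mem HFStruct.zero (ord (k + 1) : M) :=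
  (mem_ord_iff _ _).2 ⟨0, Nat.succ_pos k, rfl⟩

theorem ord_ne_pair (k : ℕ) (a b : M) : ord k ≠ pair a b := by
  cases k with
  | zero => exact (pair_ne_zero a b).symm
  | succ k => exact fun h => not_zero_mem_pair a b (h ▸ zero_mem_ord_succ k)

/-- Numerals are the successors of nothing but the preceding numerals. -/
theorem eq_ord_of_succ_eq {a : M} {k : ℕ} (h : HFStruct.eats a a = ord (k + 1)) : a = ord k := by
  have h1 : HFStruct.mem a (ord (k + 1)) := h ▸ (mem_eats_iff a a a).2 (.inr rfl)
  obtain ⟨j, hj, rfl⟩ := (mem_ord_iff _ _).1 h1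
  have h2 : (ord (j + 1) : M) = ord (k + 1) := h
  rw [ord_inj] at h2
  rw [Nat.succ.inj h2]

theorem tag_inj {j k : ℕ} : (tag j : M) = tag k ↔ j = k := by
  refine ⟨fun h => ?_, fun h => h ▸ rfl⟩
  have h0 : ∀ k, (tag k : M) ≠ HFStruct.zero := fun k => by
    cases k <;> exact pair_ne_zero _ _
  induction j generalizing k with
  | zero =>
    cases k with
    | zero => rfl
    | succ k => exact absurd (pair_inj.1 h).2.symm (h0 k)
  | succ j ih =>
    cases k with
    | zero => exact absurd (pair_inj.1 h).2 (h0 j)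
    | succ k => rw [ih (pair_inj.1 h).2]

end HFModel

/-! ## Quotation of codes -/

/-- The quotation of a pair, in terms of the quotations of its members. -/
def quotPair {n : ℕ} (a b : Tm n) : Tm n :=
  qEats (qEats .zero (qEats (qEats .zero b) a)) (qEats (qEats .zero a) a)

theorem quot_hpair {n m : ℕ} (a b : Tm n) :
    ((hpair a b).quot : Tm m) = quotPair a.quot b.quot := rfl

/-- `y` is the quotation of the canonical term for the code `x`: there is a set of pairs that
contains `⟨x, y⟩` and is generated by the clauses for `0`, pairs and successors. -/
def quoteP {n : ℕ} (x y : Tm n) : Fm n :=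
  exB fun s => hpair x y IN s AND all2 s fun p => p EQ hpair .zero .zero OR
    exB fun a => exB fun a' => exB fun b => exB fun b' =>
      hpair a a' IN s AND hpair b b' IN s AND
        (p EQ hpair (hpair a b) (quotPair a' b') OR
          -- The last conjunct keeps this clause apart from the pair clause in models without
          -- foundation: nonzero numerals contain 0 and pairs do not.
          p EQ hpair (succ a) (qEats a' a') AND .zero IN succ a)

/-- The closed terms that are built from numerals by pairing. -/
inductive IsCodeTm {n : ℕ} : Tm n → Prop
  | ord (k : ℕ) : IsCodeTm (ordOf k)
  | pair {a b : Tm n} : IsCodeTm a → IsCodeTm b → IsCodeTm (hpair a b)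

theorem isCodeTm_htuple {n : ℕ} (k : ℕ) : IsCodeTm (htuple k : Tm n) := by
  induction k with
  | zero => exact .pair (.ord 0) (.ord 0)
  | succ k ih => exact .pair (.ord 0) ih

theorem Tm.isCodeTm_quot {m n : ℕ} (t : Tm m) : IsCodeTm (t.quot : Tm n) := by
  induction t with
  | zero => exact .ord 0
  | var i => exact .ord (i + 1)
  | ind k => exact .pair (isCodeTm_htuple 6) (.ord k)
  | eats t u iht ihu => exact .pair (isCodeTm_htuple 1) (.pair iht ihu)

theorem Fm.isCodeTm_quot {m n : ℕ} (A : Fm m) : IsCodeTm (A.quot : Tm n) := by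
  induction A with
  | mem t u => exact .pair (isCodeTm_htuple 0) (.pair t.isCodeTm_quot u.isCodeTm_quot)
  | eq t u => exact .pair (isCodeTm_htuple 2) (.pair t.isCodeTm_quot u.isCodeTm_quot)
  | disj A B ihA ihB => exact .pair (isCodeTm_htuple 3) (.pair ihA ihB)
  | neg A ih => exact .pair (isCodeTm_htuple 4) ih
  | ex A ih => exact .pair (isCodeTm_htuple 5) ih

theorem quot_ordOf_eq (m n l k : ℕ) :
    ((ordOf k : Tm m).quot : Tm l) = (ordOf k : Tm n).quot := by
  induction k with
  | zero => rfl
  | succ k ih => simp only [ordOf, succ, Tm.quot, ih]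

theorem quot_htuple_eq (m n l k : ℕ) :
    ((htuple k : Tm m).quot : Tm l) = (htuple k : Tm n).quot := by
  induction k with
  | zero => rfl
  | succ k ih => simp only [htuple, hpair, Tm.quot, ih]

/-- In `selfApply` the term for a code stands below a quantifier, hence in `Tm 1`, while `quoteP` is
evaluated for the same term in `Tm 0`. Quotation does not see the difference. -/
theorem Tm.quot_quot_eq (m n l : ℕ) {k : ℕ} (t : Tm k) :
    ((t.quot : Tm m).quot : Tm l) = (t.quot : Tm n).quot := by
  induction t <;>
    simp_all [Tm.quot, quot_hpair, qInd, qEats, quot_htuple_eq m n, quot_ordOf_eq m n]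

theorem Fm.quot_quot_eq (m n l : ℕ) {k : ℕ} (A : Fm k) :
    ((A.quot : Tm m).quot : Tm l) = (A.quot : Tm n).quot := by
  induction A <;>
    simp_all [Fm.quot, quot_hpair, qMem, qEq, qDisj, qNeg, qEx, quot_htuple_eq m n,
      Tm.quot_quot_eq m n]

section QuoteRel

variable {M : Type} [HFModel M]

/-- The value of `quotPair`. -/
def pairCode (a b : M) : M :=
  eatsCode (eatsCode HFStruct.zero (eatsCode (eatsCode HFStruct.zero b) a))
    (eatsCode (eatsCode HFStruct.zero a) a)

theorem val_quotPair {n : ℕ} (e : ℕ → M) (b : Fin n → M) (t u : Tm n) :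
    (quotPair t u).val e b = pairCode (t.val e b) (u.val e b) := by
  simp [quotPair, pairCode]

/-- The clauses that generate the quotation relation `s`. -/
def QuoteStep (s p : M) : Prop :=
  p = pair HFStruct.zero HFStruct.zero ∨ ∃ a a' b b', HFStruct.mem (pair a a') s ∧
    HFStruct.mem (pair b b') s ∧ (p = pair (pair a b) (pairCode a' b') ∨
      p = pair (HFStruct.eats a a) (eatsCode a' a') ∧
        HFStruct.mem HFStruct.zero (HFStruct.eats a a))

theorem sat_quoteP {n : ℕ} (e : ℕ → M) (b : Fin n → M) (x y : Tm n) :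
    (quoteP x y).sat e b ↔ ∃ s, HFStruct.mem (pair (x.val e b) (y.val e b)) s ∧
      ∀ p, HFStruct.mem p s → QuoteStep s p := by
  simp [quoteP, QuoteStep, val_quotPair]

theorem QuoteStep.mono {s s' p : M} (h : QuoteStep s p)
    (hs : ∀ q, HFStruct.mem q s → HFStruct.mem q s') : QuoteStep s' p := by
  rcases h with h | ⟨a, a', b, b', ha, hb, h⟩
  · exact .inl h
  · exact .inr ⟨a, a', b, b', hs _ ha, hs _ hb, h⟩

theorem QuoteStep.eats {s p : M} (hs : ∀ q, HFStruct.mem q s → QuoteStep s q)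
    (h : QuoteStep s p) (q : M) (hq : HFStruct.mem q (HFStruct.eats s p)) :
    QuoteStep (HFStruct.eats s p) q := by
  have hsub : ∀ q, HFStruct.mem q s → HFStruct.mem q (HFStruct.eats s p) :=
    fun q hq => (HFModel.mem_eats_iff _ _ _).2 (.inl hq)
  rcases (HFModel.mem_eats_iff _ _ _).1 hq with hq | rfl
  exacts [(hs q hq).mono hsub, h.mono hsub]

variable {n m : ℕ} (e : ℕ → M) (b : Fin n → M) (b' : Fin m → M)

/-- The model need not have unions, so the set is threaded through as an accumulator: the second
component of a pair extends the set obtained for the first. Each new pair is added by ◁, and earlier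
steps stay justified because `QuoteStep` is monotone in the set. -/
theorem exists_quoteSet {c : Tm n} (hc : IsCodeTm c) (s : M)
    (hs : ∀ q, HFStruct.mem q s → QuoteStep s q) :
    ∃ s', (∀ q, HFStruct.mem q s → HFStruct.mem q s') ∧
      (∀ q, HFStruct.mem q s' → QuoteStep s' q) ∧
      HFStruct.mem (pair (c.val e b) ((c.quot : Tm m).val e b')) s' := by
  have step : ∀ {s s₀ p : M}, (∀ q, HFStruct.mem q s₀ → HFStruct.mem q s) →
      (∀ q, HFStruct.mem q s → QuoteStep s q) → QuoteStep s p →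
      ∃ s', (∀ q, HFStruct.mem q s₀ → HFStruct.mem q s') ∧
        (∀ q, HFStruct.mem q s' → QuoteStep s' q) ∧ HFStruct.mem p s' :=
    fun {s _ p} h₀ hs hp => ⟨HFStruct.eats s p,
      fun q hq => (HFModel.mem_eats_iff _ _ _).2 (.inl (h₀ q hq)), QuoteStep.eats hs hp,
      (HFModel.mem_eats_iff _ _ _).2 (.inr rfl)⟩
  induction hc generalizing s with
  | ord k =>
    induction k with
    | zero => exact step (fun _ h => h) hs (.inl rfl)
    | succ k ih =>
      obtain ⟨s₁, h₁, hs₁, hk⟩ := ih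
      refine step h₁ hs₁ (.inr ⟨_, _, _, _, hk, hk, .inr ⟨rfl, ?_⟩⟩)
      rw [val_ordOf]
      exact HFModel.zero_mem_ord_succ k
  | pair _ _ iha ihb =>
    obtain ⟨s₁, h₁, hs₁, ha⟩ := iha s hs
    obtain ⟨s₂, h₂, hs₂, hb⟩ := ihb s₁ hs₁
    exact step (fun q hq => h₂ q (h₁ q hq)) hs₂
      (.inr ⟨_, _, _, _, h₂ _ ha, hb, .inl rfl⟩)

/-- The set `s` may contain nonstandard elements, but external induction on `c` decides the matter:
0, successor numerals and pairs are pairwise distinct, so only the clause of the shape of `c` can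
justify a pair with that first component. -/
theorem quoteSet_unique {c : Tm n} (hc : IsCodeTm c) {s y : M}
    (hs : ∀ q, HFStruct.mem q s → QuoteStep s q) (h : HFStruct.mem (pair (c.val e b) y) s) :
    y = (c.quot : Tm m).val e b' := by
  induction hc generalizing y with
  | ord k =>
    rw [val_ordOf] at h
    induction k generalizing y with
    | zero =>
      rcases hs _ h with h | ⟨a, a', b, b', _, _, h | ⟨h, h0⟩⟩
      · exact (HFModel.pair_inj.1 h).2
      · exact absurd (HFModel.pair_inj.1 h).1.symm (HFModel.pair_ne_zero _ _)
      · rw [← (HFModel.pair_inj.1 h).1] at h0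
        exact absurd h0 (HFModel.not_mem_zero _)
    | succ k ih =>
      rcases hs _ h with h | ⟨a, a', b, b', ha, _, h | ⟨h, h0⟩⟩
      · have := (HFModel.pair_inj.1 h).1
        exact absurd (HFModel.zero_mem_ord_succ k) (this ▸ HFModel.not_mem_zero (M := M) _)
      · exact absurd (HFModel.pair_inj.1 h).1 (HFModel.ord_ne_pair _ _ _)
      · obtain ⟨h1, rfl⟩ := HFModel.pair_inj.1 h
        rw [HFModel.eq_ord_of_succ_eq h1.symm] at ha
        rw [ih ha]
        simp [ordOf, succ, Tm.quot, eatsCode]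
  | pair _ _ iha ihb =>
    rw [val_hpair] at h
    rcases hs _ h with h | ⟨a, a', b, b', ha, hb, h | ⟨h, h0⟩⟩
    · exact absurd (HFModel.pair_inj.1 h).1 (HFModel.pair_ne_zero _ _)
    · obtain ⟨h1, rfl⟩ := HFModel.pair_inj.1 h
      obtain ⟨rfl, rfl⟩ := HFModel.pair_inj.1 h1
      rw [iha ha, ihb hb, quot_hpair, val_quotPair]
    · rw [← (HFModel.pair_inj.1 h).1] at h0
      exact absurd h0 (HFModel.not_zero_mem_pair _ _)

theorem sat_quoteP_iff {c : Tm m} (hc : IsCodeTm c) {x y : Tm n} (hx : x.val e b = c.val e b') :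
    (quoteP x y).sat e b ↔ y.val e b = (c.quot : Tm m).val e b' := by
  rw [sat_quoteP, hx]
  constructor
  · rintro ⟨s, h, hs⟩
    exact quoteSet_unique e b' b' hc hs h
  · intro hy
    obtain ⟨s, _, hs, h⟩ := exists_quoteSet e b' b' hc HFStruct.zero
      fun q hq => absurd hq (HFModel.not_mem_zero q)
    exact ⟨s, hy ▸ h, hs⟩

end QuoteRel

/-! ## Free variables -/

theorem Tm.notMem_fv_subst_zero {n : ℕ} (i : ℕ) (t : Tm n) : i ∉ (t.subst i .zero).fv := by
  induction t with
  | var k => by_cases h : i = k <;> simp [Tm.subst, Tm.fv, h]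
  | _ => simp_all [Tm.subst, Tm.fv]

theorem Fm.notMem_fv_subst_zero {n : ℕ} (i : ℕ) (A : Fm n) : i ∉ (A.subst i .zero).fv := by
  induction A <;> simp_all [Fm.subst, Fm.fv, Tm.notMem_fv_subst_zero, Tm.lift]

/-- Substituting 0 removes the variable. Free variables of large predicates can thus be bounded by
the substitution lemmas alone, and the coded notion `varNonOccFormP` uses the same test. -/
theorem Fm.notMem_fv_of_subst_eq {n : ℕ} {i : ℕ} {A : Fm n} (h : A.subst i .zero = A) :
    i ∉ A.fv := h ▸ A.notMem_fv_subst_zero i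

theorem Fm.fv_quot {m n : ℕ} (A : Fm m) : (A.quot : Tm n).fv = ∅ :=
  Finset.eq_empty_of_forall_notMem fun i h => by
    rw [← subst_quot i .zero] at h
    exact Tm.notMem_fv_subst_zero i _ h

theorem fv_pfP {n : ℕ} (E : Fm 0) {t : Tm n} {i : ℕ} (h : i ∈ (pfP E t).fv) : i ∈ t.fv := by
  by_contra hi
  have := Fm.notMem_fv_subst_zero i (pfP E t)
  rw [subst_pfP, Tm.subst_of_notMem hi] at this
  exact this h

theorem Tm.fv_abst {n : ℕ} (i : ℕ) (t : Tm n) : (t.abst i).fv = t.fv.erase i := by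
  induction t with
  | var k =>
    by_cases h : i = k
    · simp [Tm.abst, Tm.fv, h]
    · simp [Tm.abst, Tm.fv, h, Finset.erase_eq_of_notMem]
  | _ => simp_all [Tm.abst, Tm.fv, Finset.erase_union_distrib]

theorem Fm.fv_abst {n : ℕ} (i : ℕ) (A : Fm n) : (A.abst i).fv = A.fv.erase i := by
  induction A <;> simp_all [Fm.abst, Fm.fv, Tm.fv_abst, Finset.erase_union_distrib]

/-! ## The Gödel sentence -/

/-- The code of `∃ x. x = y ∧ A` where `x` is the code of `A` and `y` that of a term. -/
def qExEq {n : ℕ} (x y : Tm n) : Tm n :=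
  qEx (qNeg (qDisj (qNeg (qEq (qInd .zero) y)) (qNeg x)))

/-- `∃ z = qExEq v₀ ⌜v₀⌝. ¬ Pf z`. -/
def diagFm (E : Fm 0) : Fm 0 :=
  .exN 1 (quoteP (.var 0) (.var 1) AND
    .exN 2 (.var 2 EQ qExEq (.var 0) (.var 1) AND .neg (pfP E (.var 2))))

/-- The sentence which says that `A` holds of its own code. -/
def selfApply (A : Fm 0) : Fm 0 := .ex (.ind 0 EQ (A.abst 0).quot AND A.abst 0)

/-- The Gödel sentence. -/
def goedelSentence (E : Fm 0) : Fm 0 := selfApply (diagFm E)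

theorem subst_quoteP {n : ℕ} (i : ℕ) (x t u : Tm n) :
    (quoteP t u).subst i x = quoteP (t.subst i x) (u.subst i x) := by
  simp [quoteP, exB, all2, quotPair, qEats, succ, Fm.subst, Tm.subst, Tm.lift_subst]

theorem subst_qExEq {n : ℕ} (i : ℕ) (x t u : Tm n) :
    (qExEq t u).subst i x = qExEq (t.subst i x) (u.subst i x) := by
  simp [qExEq, qEx, qNeg, qDisj, qEq, qInd, Tm.subst]

theorem fv_selfApply (A : Fm 0) : (selfApply A).fv = A.fv.erase 0 := by
  simp [selfApply, Fm.conj, Fm.fv, Fm.fv_abst, Fm.fv_quot, Tm.fv]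

theorem fv_exN (i : ℕ) (A : Fm 0) : (Fm.exN i A).fv = A.fv.erase i := Fm.fv_abst i A

theorem fv_conj {n : ℕ} (A B : Fm n) : (A AND B).fv = A.fv ∪ B.fv := rfl

theorem fv_neg {n : ℕ} (A : Fm n) : A.neg.fv = A.fv := rfl

theorem mem_of_mem_fv_quoteP {i : ℕ} (h : i ∈ (quoteP (.var 0) (.var 1) : Fm 0).fv) :
    i = 0 ∨ i = 1 := by
  by_contra hi
  rw [not_or] at hi
  exact Fm.notMem_fv_of_subst_eq (by simp [subst_quoteP, Tm.subst, hi.1, hi.2]) h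

theorem mem_of_mem_fv_qExEq {i : ℕ} (h : i ∈ (.var 2 EQ qExEq (.var 0) (.var 1) : Fm 0).fv) :
    i = 0 ∨ i = 1 ∨ i = 2 := by
  by_contra hi
  rw [not_or, not_or] at hi
  exact Fm.notMem_fv_of_subst_eq
    (by simp [Fm.subst, subst_qExEq, Tm.subst, hi.1, hi.2.1, hi.2.2]) h

theorem erase_eq_empty {s t u : Finset ℕ} (hs : ∀ i ∈ s, i = 0 ∨ i = 1)
    (ht : ∀ i ∈ t, i = 0 ∨ i = 1 ∨ i = 2) (hu : ∀ i ∈ u, i = 2) :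
    ((s ∪ (t ∪ u).erase 2).erase 1).erase 0 = ∅ := by
  ext i
  have := hs i
  have := ht i
  have := hu i
  simp only [Finset.mem_erase, Finset.mem_union, Finset.notMem_empty]
  tauto

theorem goedelSentence_ground (E : Fm 0) : (goedelSentence E).Ground := by
  rw [Fm.Ground, goedelSentence, fv_selfApply, diagFm, fv_exN, fv_conj, fv_exN, fv_conj, fv_neg]
  exact erase_eq_empty (fun i => mem_of_mem_fv_quoteP) (fun i => mem_of_mem_fv_qExEq)
    fun i h => Finset.mem_singleton.1 (fv_pfP E h)

theorem sat_abst_cons {M : Type} [HFStruct M] (i : ℕ) (A : Fm 0) (e : ℕ → M) (b : Fin 0 → M)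
    (x : M) : (A.abst i).sat e (Fin.cons x b) ↔ A.sat (Function.update e i x) b := by
  rw [← Fm.sat_abst, show (Fin.cons x b : Fin 1 → M) = Fin.snoc b x from
    funext fun k => by rw [Fin.fin_one_eq_zero k]; rfl]

theorem sat_selfApply {M : Type} [HFStruct M] (A : Fm 0) (e : ℕ → M) (b : Fin 0 → M) :
    (selfApply A).sat e b ↔ A.sat (Function.update e 0 ((A.abst 0).code M)) b := by
  simp [selfApply, sat_abst_cons]

/-- This is why the diagonal sentence is written with ∃ and an equation: its code is an explicit
term in ⌜A⌝ and ⌜⌜A⌝⌝, with no coded substitution. -/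
theorem quot_selfApply (A : Fm 0) :
    ((selfApply A).quot : Tm 0) = qExEq (A.abst 0).quot ((A.abst 0).quot : Tm 0).quot := by
  rw [Fm.quot_quot_eq 0 1]
  rfl

theorem sat_pfP_var_iff {M : Type} [HFStruct M] (E A : Fm 0) {i : ℕ} {e : ℕ → M} (e' : ℕ → M)
    (b : Fin 0 → M) (h : e i = A.code M) :
    (pfP E (.var i)).sat e b ↔ (pfP E A.quot).sat e' b := by
  have h1 : (pfP E (.var i) : Fm 0).subst i A.quot = pfP E A.quot := by simp [Tm.subst]
  rw [Fm.sat_congr b fun k hk => show e' k = e k by simpa [Fm.fv_quot] using fv_pfP E hk, ← h1,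
    Fm.sat_subst, Fm.val_quot, ← h, Function.update_eq_self]

/-- A standard code has exactly one quotation in the model, so the first quantifier has a single
witness, and the equation forces the second to be the code of `selfApply A`. The assignment `e'` is
arbitrary because `pfP` of a closed term is closed. -/
theorem sat_diagFm {M : Type} [HFModel M] (E A : Fm 0) {e : ℕ → M} (e' : ℕ → M) (b : Fin 0 → M)
    (h : e 0 = (A.abst 0).code M) :
    (diagFm E).sat e b ↔ ¬ (pfP E (selfApply A).quot).sat e' b := by
  have hq : ∀ y : M, (quoteP (.var 0) (.var 1)).sat (Function.update e 1 y) b ↔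
      y = (((A.abst 0).quot : Tm 0).quot : Tm 0).val e' b := by
    intro y
    have := sat_quoteP_iff (Function.update e 1 y) b b ((A.abst 0).isCodeTm_quot (n := 0))
      (x := .var 0) (y := .var 1) (by rw [Fm.val_quot]; exact h)
    rwa [Tm.val_quot, ← Tm.val_quot e' b] at this
  have hz : (qExEq (.var 0) (.var 1) : Tm 0).val (Function.update e 1
      ((((A.abst 0).quot : Tm 0).quot : Tm 0).val e' b)) b = (selfApply A).code M := by
    rw [← Fm.val_quot e' b, quot_selfApply]
    simp [qExEq, h]
  rw [diagFm, Fm.sat_exN]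
  simp only [Fm.sat_conj, hq, exists_eq_left, Fm.sat_exN, Fm.sat_eq, Fm.sat_neg]
  have hz2 : ∀ z : M, (qExEq (.var 0) (.var 1) : Tm 0).val (Function.update (Function.update e 1
      ((((A.abst 0).quot : Tm 0).quot : Tm 0).val e' b)) 2 z) b = (selfApply A).code M := by
    intro z
    rw [← hz]
    simp [qExEq]
  simp only [hz2, Tm.val_var, Function.update_self, exists_eq_left]
  rw [sat_pfP_var_iff E (selfApply A) e' b (Function.update_self _ _ _)]

theorem sat_goedelSentence {M : Type} [HFModel M] (E : Fm 0) (e : ℕ → M) (b : Fin 0 → M) :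
    (goedelSentence E).sat e b ↔ ¬ (pfP E (goedelSentence E).quot).sat e b := by
  rw [goedelSentence, sat_selfApply]
  exact sat_diagFm E _ e b (Function.update_self _ _ _)

theorem goedelSentence_fixed_point [Countable (Fm 1)] (E : Fm 0) :
    HFThm E ∅ ((goedelSentence E).iff (pfP E (goedelSentence E).quot).neg) :=
  .complete _ _ fun M _ e b => by
    rw [Fm.sat_iff, Fm.sat_neg]
    exact sat_goedelSentence E e b

/-! ## Injectivity of coding -/

instance : HFModel HFSet where
  not_mem_zero := HFSet.not_mem_empty
  mem_eats_iff := HFSet.mem_eats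

section Injective

variable {M : Type} [HFModel M]

open HFModel

/-- Codes of terms. -/
theorem Tm.code_injective {n : ℕ} : Function.Injective (Tm.code M : Tm n → M) := by
  intro t u h
  induction t generalizing u with
  | zero =>
    cases u with
    | zero => rfl
    | var i => exact absurd ((ord_inj (M := M) (j := 0) (k := i + 1)).1 h) (by omega)
    | ind k => exact absurd h.symm (pair_ne_zero _ _)
    | eats t u => exact absurd h.symm (pair_ne_zero _ _)
  | var i =>
    cases u with
    | zero => exact absurd ((ord_inj (M := M) (j := i + 1) (k := 0)).1 h) (by omega)
    | var j => rw [Nat.succ.inj (ord_inj.1 h)]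
    | ind k => exact absurd h (ord_ne_pair _ _ _)
    | eats t u => exact absurd h (ord_ne_pair _ _ _)
  | ind k =>
    cases u with
    | zero => exact absurd h (pair_ne_zero _ _)
    | var j => exact absurd h.symm (ord_ne_pair _ _ _)
    | ind k => rw [Fin.ext (ord_inj.1 (pair_inj.1 h).2)]
    | eats t u => exact absurd (tag_inj.1 (pair_inj.1 h).1) (by decide)
  | eats t t' iht iht' =>
    cases u with
    | zero => exact absurd h (pair_ne_zero _ _)
    | var j => exact absurd h.symm (ord_ne_pair _ _ _)
    | ind k => exact absurd (tag_inj.1 (pair_inj.1 h).1) (by decide)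
    | eats u u' =>
      have := pair_inj.1 (pair_inj.1 h).2
      rw [iht this.1, iht' this.2]

theorem Fm.code_injective {n : ℕ} : Function.Injective (Fm.code M : Fm n → M) := by
  intro A B h
  induction A <;> cases B <;>
    simp only [Fm.code, memCode, eqCode, disjCode, negCode, exCode, pair_inj, tag_inj,
      Tm.code_injective.eq_iff, OfNat.ofNat_ne_zero, OfNat.zero_ne_ofNat, false_and,
      Nat.reduceEqDiff, true_and] at h
  case mem.mem => rw [h.1, h.2]
  case eq.eq => rw [h.1, h.2]
  case disj.disj ihA ihB _ _ => rw [ihA h.1, ihB h.2]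
  case neg.neg ih _ => rw [ih h]
  case ex.ex ih _ => rw [ih h]

end Injective

/-- Coding embeds the formulas into `HFSet`, which is ℕ; this discharges the countability assumption
of the completeness theorem. -/
instance {n : ℕ} : Countable (Fm n) :=
  have : Countable HFSet := inferInstanceAs (Countable ℕ)
  (Fm.code_injective (M := HFSet)).countable

/-! ## Ordinals and sequences -/

section Sequences

variable {n : ℕ} (e : ℕ → HFSet) (b : Fin n → HFSet)

/-- By ∈-induction every member of `x` is a numeral. As `x` is finite, there is a least numeral
outside it, and transitivity makes `x` equal to that numeral. -/
theorem eq_ord_of_transitive (x : HFSet)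
    (h : ∀ y : HFSet, HFStruct.mem y x → (∀ z : HFSet, HFStruct.mem z y → HFStruct.mem z x) ∧
      ∀ z : HFSet, HFStruct.mem z y → ∀ w : HFSet, HFStruct.mem w z → HFStruct.mem w y) :
    ∃ k, x = ord k := by
  classical
  induction x using HFSet.mem_wf.induction with
  | _ x ih =>
  have hord : ∀ y : HFSet, HFStruct.mem y x → ∃ k, y = ord k := fun y hy =>
    ih y hy fun z hz => ⟨(h y hy).2 z hz, (h z ((h y hy).1 z hz)).2⟩
  have hex : ∃ k, ¬ HFStruct.mem (ord k) x := by
    by_contra hcon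
    push Not at hcon
    exact Set.infinite_of_injective_forall_mem (s := {y : HFSet | y ∈ x}) (f := ord)
      (fun i j h => HFModel.ord_inj.1 h) hcon (HFSet.finite_mem x)
  refine ⟨Nat.find hex, HFSet.ext fun z => ?_⟩
  refine Iff.trans ?_ (HFModel.mem_ord_iff z (Nat.find hex)).symm
  constructor
  · intro hz
    obtain ⟨k, rfl⟩ := hord z hz
    refine ⟨k, ?_, rfl⟩
    by_contra hk
    rcases (not_lt.1 hk).lt_or_eq with hk | hk
    · exact Nat.find_spec hex ((h _ hz).1 _ ((HFModel.mem_ord_iff _ _).2 ⟨_, hk, rfl⟩))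
    · exact Nat.find_spec hex (hk ▸ hz)
  · rintro ⟨k, hk, rfl⟩
    exact not_not.1 (Nat.find_min hex hk)

@[simp] theorem sat_ordP (t : Tm n) : (ordP t).sat e b ↔ ∃ k, t.val e b = ord k := by
  simp only [ordP, subsetP, sat_all2, Fm.sat_conj, Fm.sat_mem, Tm.val_ind, Tm.val_lift,
    Fin.cons_zero]
  refine ⟨eq_ord_of_transitive _, ?_⟩
  rintro ⟨k, hk⟩
  simp only [hk, HFModel.mem_ord_iff]
  rintro _ ⟨j, hj, rfl⟩
  simp only [HFModel.mem_ord_iff]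
  refine ⟨?_, ?_⟩
  · rintro _ ⟨i, hi, rfl⟩
    exact ⟨i, hi.trans hj, rfl⟩
  · rintro _ ⟨i, hi, rfl⟩ w hw
    obtain ⟨l, hl, rfl⟩ := (HFModel.mem_ord_iff _ _).1 hw
    exact ⟨l, hl.trans hi, rfl⟩

/-- The sets that can be derived by a rule with two premises. -/
inductive Deriv (B : HFSet → Prop) (R : HFSet → HFSet → HFSet → Prop) : HFSet → Prop
  | base {x : HFSet} : B x → Deriv B R x
  | rule {a b x : HFSet} : R a b x → Deriv B R a → Deriv B R b → Deriv B R x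

theorem Deriv.exists_seq {B : HFSet → Prop} {R : HFSet → HFSet → HFSet → Prop} {y : HFSet}
    (h : Deriv B R y) : ∃ (k : ℕ) (f : ℕ → HFSet), f k = y ∧
      ∀ i ≤ k, B (f i) ∨ ∃ j < i, ∃ l < i, R (f j) (f l) (f i) := by
  induction h with
  | @base x hx => exact ⟨0, fun _ => x, rfl, fun i _ => .inl hx⟩
  | @rule a b x hx _ _ iha ihb =>
    obtain ⟨k, f, hf, hfk⟩ := iha
    obtain ⟨l, g, hg, hgl⟩ := ihb
    -- Concatenation: `f` occupies the places 0 to k, `g` the next l + 1 places, and `x` comes at k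
    -- + l + 2.
    let s : ℕ → HFSet := fun i => if i ≤ k then f i else if i ≤ k + 1 + l then g (i - (k + 1)) else x
    have s1 : ∀ i ≤ k, s i = f i := fun i hi => if_pos hi
    have s2 : ∀ i ≤ l, s (k + 1 + i) = g i := fun i hi => by
      simp only [s]
      rw [if_neg (by omega), if_pos (by omega), Nat.add_sub_cancel_left]
    have s3 : s (k + 1 + l + 1) = x := by
      simp only [s]
      rw [if_neg (by omega), if_neg (by omega)]
    refine ⟨k + 1 + l + 1, s, s3, fun i hi => ?_⟩
    rcases Nat.lt_or_ge k i with hki | hki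
    · obtain ⟨i, rfl⟩ : ∃ j, i = k + 1 + j := ⟨i - (k + 1), by omega⟩
      rcases Nat.lt_or_ge l i with hli | hli
      · obtain rfl : i = l + 1 := by omega
        refine .inr ⟨k, by omega, k + 1 + l, by omega, ?_⟩
        rw [s1 k le_rfl, s2 l le_rfl, hf, hg]
        exact (s3 ▸ hx :)
      · rw [s2 i hli]
        rcases hgl i hli with h | ⟨j, hj, m, hm, h⟩
        · exact .inl h
        · refine .inr ⟨k + 1 + j, by omega, k + 1 + m, by omega, ?_⟩
          rwa [s2 j (by omega), s2 m (by omega)]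
    · rw [s1 i hki]
      rcases hfk i hki with h | ⟨j, hj, m, hm, h⟩
      · exact .inl h
      · refine .inr ⟨j, hj, m, hm, ?_⟩
        rwa [s1 j (by omega), s1 m (by omega)]

theorem exists_graph (k : ℕ) (f : ℕ → HFSet) : ∃ s : HFSet, ∀ p : HFSet,
    HFStruct.mem p s ↔ ∃ i ≤ k, p = pair (ord i) (f i) := by
  classical
  obtain ⟨s, hs⟩ := HFSet.exists_of_finset
    ((Finset.range (k + 1)).image fun i => (pair (ord i) (f i) : HFSet))
  exact ⟨s, fun p => (hs p).trans (by simp [eq_comm])⟩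

theorem sat_functionP (s : Tm n) : (functionP s).sat e b ↔
    ∀ p : HFSet, HFStruct.mem p (s.val e b) → ∀ q : HFSet, HFStruct.mem q (s.val e b) →
      ∃ x y x' y' : HFSet, p = pair x y ∧ q = pair x' y' ∧ (x ≠ x' ∨ y = y') := by
  simp [functionP]

/-- The common tool for all coded recursions. The hypotheses `hB` and `hR` interpret the clauses
under the assignment extended by the quantifiers of `derivP`, and ask that only the members of the
sequence matter. Single-valuedness of the sequence then allows induction on the place; conversely a
derivation is linearised by `Deriv.exists_seq`. -/
theorem sat_derivP {y : Tm n}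
    {base : Tm (n + 1 + 1 + 1 + 1) → Fm (n + 1 + 1 + 1 + 1)}
    {rule : Tm (n + 1 + 1 + 1 + 1 + 1 + 1 + 1 + 1) → Tm (n + 1 + 1 + 1 + 1 + 1 + 1 + 1 + 1) →
      Tm (n + 1 + 1 + 1 + 1 + 1 + 1 + 1 + 1) → Fm (n + 1 + 1 + 1 + 1 + 1 + 1 + 1 + 1)}
    (B : HFSet → Prop) (R : HFSet → HFSet → HFSet → Prop)
    (hB : ∀ k s i x : HFSet, (base (.ind 0)).sat e
      (Fin.cons x (Fin.cons i (Fin.cons s (Fin.cons k b)))) ↔ B x)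
    (hR : ∀ k s i x j l a c : HFSet,
      (rule (Tm.lift (.ind 0)) (.ind 0) (Tm.lift (Tm.lift (Tm.lift (Tm.lift (.ind 0)))))).sat e
        (Fin.cons c (Fin.cons a (Fin.cons l (Fin.cons j
          (Fin.cons x (Fin.cons i (Fin.cons s (Fin.cons k b)))))))) ↔ R a c x) :
    (derivP y base rule).sat e b ↔ Deriv B R (y.val e b) := by
  have key : (derivP y base rule).sat e b ↔ ∃ k s : HFSet,
      ((∃ m, k = ord m) ∧ (∀ i : HFSet, HFStruct.mem i (HFStruct.eats k k) →
          ∃ x : HFSet, HFStruct.mem (pair i x) s) ∧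
        (∀ p : HFSet, HFStruct.mem p s → ∀ q : HFSet, HFStruct.mem q s →
          ∃ x y x' y' : HFSet, p = pair x y ∧ q = pair x' y' ∧ (x ≠ x' ∨ y = y')) ∧
        HFStruct.mem (pair k (y.val e b)) s) ∧
      ∀ i : HFSet, HFStruct.mem i (HFStruct.eats k k) → ∃ x : HFSet,
        HFStruct.mem (pair i x) s ∧ (B x ∨ ∃ j l a c : HFSet, HFStruct.mem j i ∧
          HFStruct.mem l i ∧ HFStruct.mem (pair j a) s ∧ HFStruct.mem (pair l c) s ∧ R a c x) := by
    simp [derivP, lstSeqP, domainInclP, sat_functionP, hB, hR]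
  rw [key]
  constructor
  · rintro ⟨_, s, ⟨⟨k, rfl⟩, -, hfun, hy⟩, hstep⟩
    have hf : ∀ i x x' : HFSet, HFStruct.mem (pair i x) s → HFStruct.mem (pair i x') s → x = x' := by
      intro i x x' hx hx'
      obtain ⟨u, v, u', v', h, h', h''⟩ := hfun _ hx _ hx'
      obtain ⟨rfl, rfl⟩ := HFModel.pair_inj.1 h
      obtain ⟨rfl, rfl⟩ := HFModel.pair_inj.1 h'
      exact h''.resolve_left fun h => h rfl
    have hall : ∀ i ≤ k, ∀ x : HFSet, HFStruct.mem (pair (ord i) x) s → Deriv B R x := by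
      intro i
      induction i using Nat.strong_induction_on with
      | _ i ih =>
        intro hi x hx
        obtain ⟨x', hx', h⟩ := hstep (ord i)
          ((HFModel.mem_ord_iff _ (k + 1)).2 ⟨i, by omega, rfl⟩)
        obtain rfl := hf _ _ _ hx hx'
        rcases h with h | ⟨j, l, a, c, hj, hl, ha, hc, h⟩
        · exact .base h
        · obtain ⟨j, hji, rfl⟩ := (HFModel.mem_ord_iff _ _).1 hj
          obtain ⟨l, hli, rfl⟩ := (HFModel.mem_ord_iff _ _).1 hl
          exact .rule h (ih j hji (by omega) a ha) (ih l hli (by omega) c hc)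
    exact hall k le_rfl _ hy
  · intro h
    obtain ⟨k, f, hfk, hstep⟩ := h.exists_seq
    obtain ⟨s, hs⟩ := exists_graph k f
    have hmem : ∀ i ≤ k, HFStruct.mem (pair (ord i) (f i)) s := fun i hi => (hs _).2 ⟨i, hi, rfl⟩
    have hsucc : ∀ i : HFSet, HFStruct.mem i (HFStruct.eats (ord k) (ord k)) →
        ∃ j ≤ k, i = ord j := by
      intro i hi
      obtain ⟨j, hj, rfl⟩ := (HFModel.mem_ord_iff i (k + 1)).1 hi
      exact ⟨j, by omega, rfl⟩
    refine ⟨ord k, s, ⟨⟨k, rfl⟩, ?_, ?_, hfk ▸ hmem k le_rfl⟩, ?_⟩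
    · intro i hi
      obtain ⟨j, hj, rfl⟩ := hsucc i hi
      exact ⟨_, hmem j hj⟩
    · intro p hp q hq
      obtain ⟨i, -, rfl⟩ := (hs p).1 hp
      obtain ⟨j, -, rfl⟩ := (hs q).1 hq
      refine ⟨_, _, _, _, rfl, rfl, ?_⟩
      by_cases hij : i = j
      · exact .inr (by rw [hij])
      · exact .inl fun h => hij (HFModel.ord_inj.1 h)
    · intro i hi
      obtain ⟨i, hik, rfl⟩ := hsucc i hi
      refine ⟨f i, hmem i hik, (hstep i hik).imp id ?_⟩
      rintro ⟨j, hj, l, hl, h⟩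
      exact ⟨ord j, ord l, f j, f l, (HFModel.mem_ord_iff _ _).2 ⟨j, hj, rfl⟩,
        (HFModel.mem_ord_iff _ _).2 ⟨l, hl, rfl⟩, hmem j (by omega), hmem l (by omega), h⟩

end Sequences

/-! ## The coded syntax in the universe of hereditarily finite sets -/

section CodedSyntax

variable {n : ℕ} (e : ℕ → HFSet) (b : Fin n → HFSet)

@[simp] theorem sat_varP (t : Tm n) : (varP t).sat e b ↔ ∃ i, t.val e b = ord (i + 1) := by
  simp only [varP, Fm.sat_conj, sat_ordP, Fm.sat_mem, Tm.val_zero]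
  constructor
  · rintro ⟨⟨k, hk⟩, h⟩
    rw [hk, HFModel.mem_ord_iff] at h
    obtain ⟨j, hj, -⟩ := h
    exact ⟨k - 1, by rw [hk, Nat.sub_add_cancel (by omega)]⟩
  · rintro ⟨i, hi⟩
    exact ⟨⟨_, hi⟩, hi ▸ HFModel.zero_mem_ord_succ i⟩

@[simp] theorem sat_indP (t : Tm n) : (indP t).sat e b ↔ ∃ k, t.val e b = indCode (ord k) := by
  simp only [indP, sat_exB, Fm.sat_conj, sat_ordP, Fm.sat_eq, Tm.val_ind, Tm.val_lift, val_qInd,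
    Fin.cons_zero]
  constructor
  · rintro ⟨_, ⟨k, rfl⟩, h⟩
    exact ⟨k, h⟩
  · rintro ⟨k, h⟩
    exact ⟨_, ⟨k, rfl⟩, h⟩

@[simp] theorem sat_termP (t : Tm n) :
    (termP t).sat e b ↔ ∃ T : Tm 0, t.val e b = T.code HFSet := by
  rw [termP, sat_derivP e b (fun x => x = HFStruct.zero ∨ ∃ i, x = ord (i + 1))
    (fun a b x => x = eatsCode a b) (by simp) (by simp)]
  constructor
  · intro h
    generalize t.val e b = x at h
    induction h with
    | base h =>
      rcases h with rfl | ⟨i, rfl⟩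
      exacts [⟨.zero, rfl⟩, ⟨.var i, rfl⟩]
    | rule h _ _ iha ihb =>
      obtain ⟨T, rfl⟩ := iha
      obtain ⟨U, rfl⟩ := ihb
      exact ⟨.eats T U, h⟩
  · rintro ⟨T, hT⟩
    rw [hT]
    clear hT
    induction T with
    | zero => exact .base (.inl rfl)
    | var i => exact .base (.inr ⟨i, rfl⟩)
    | ind k => exact k.elim0
    | eats T U ihT ihU => exact .rule rfl ihT ihU

/-! ### Replacement of a variable in terms and atomic formulas -/

/-- The relation expressed by `stTermP`. -/
def StTerm (v u t t' : HFSet) : Prop :=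
  Deriv (fun x => x = pair v u ∨ ∃ z, x = pair z z ∧
      (z = HFStruct.zero ∨ (∃ k, z = indCode (ord k)) ∨ (∃ i, z = ord (i + 1)) ∧ z ≠ v))
    (fun a b x => ∃ p p' q q', a = pair p p' ∧ b = pair q q' ∧
      x = pair (eatsCode p q) (eatsCode p' q')) (pair t t')

@[simp] theorem sat_stTermP (v u t t' : Tm n) : (stTermP v u t t').sat e b ↔
    StTerm (v.val e b) (u.val e b) (t.val e b) (t'.val e b) := by
  rw [stTermP, sat_derivP e b (fun x => x = pair (v.val e b) (u.val e b) ∨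
      ∃ z, x = pair z z ∧ (z = HFStruct.zero ∨ (∃ k, z = indCode (ord k)) ∨
        (∃ i, z = ord (i + 1)) ∧ z ≠ v.val e b))
    (fun a b x => ∃ p p' q q', a = pair p p' ∧ b = pair q q' ∧
      x = pair (eatsCode p q) (eatsCode p' q')) (by simp) (by simp)]
  rfl

/-- The code of the term `t` with the variable `i` replaced by a term with the code `u`. -/
def Tm.replCode (i : ℕ) (u : HFSet) {n : ℕ} : Tm n → HFSet
  | .zero => HFStruct.zero
  | .var k => if i = k then u else ord (k + 1)
  | .ind k => indCode (ord k)
  | .eats t t' => eatsCode (t.replCode i u) (t'.replCode i u)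

/-- One coded replacement serves two purposes: with the code of a term it is substitution, and with
the code of the index `n`, outermost below `n` quantifiers, it is abstraction (`replCode_indCode`).
-/
theorem Tm.replCode_code (i : ℕ) (x t : Tm n) :
    t.replCode i (x.code HFSet) = (t.subst i x).code HFSet := by
  induction t with
  | var k => by_cases h : i = k <;> simp [replCode, Tm.subst, Tm.code, h]
  | _ => simp_all [replCode, Tm.subst, Tm.code]

theorem Tm.replCode_indCode (i : ℕ) (t : Tm n) :
    t.replCode i (indCode (ord n)) = (t.abst i).code HFSet := by
  induction t with
  | var k => by_cases h : i = k <;> simp [replCode, Tm.abst, Tm.code, h]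
  | _ => simp_all [replCode, Tm.abst, Tm.code]

theorem stTerm_iff (i : ℕ) (u t' : HFSet) (t : Tm n) :
    StTerm (ord (i + 1)) u (t.code HFSet) t' ↔ t' = t.replCode i u := by
  constructor
  · intro h
    rw [StTerm] at h
    generalize hp : pair (t.code HFSet) t' = p at h
    induction h generalizing t t' with
    | base h =>
      subst hp
      simp only [HFModel.pair_inj] at h
      rcases h with ⟨h, rfl⟩ | ⟨z, ⟨rfl, rfl⟩, h⟩
      · obtain rfl : t = .var i := Tm.code_injective h
        simp [Tm.replCode]
      · cases t with
        | zero => rfl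
        | var k =>
          have hk : (ord (k + 1) : HFSet) ≠ ord (i + 1) := by
            rcases h with h | ⟨j, h⟩ | ⟨-, h⟩
            · exact absurd ((HFModel.ord_inj (M := HFSet) (j := k + 1) (k := 0)).1 h) (by omega)
            · exact absurd h (HFModel.ord_ne_pair _ _ _)
            · exact h
          have : i ≠ k := fun h => hk (by rw [h])
          simp [Tm.replCode, Tm.code, this]
        | ind k => rfl
        | eats t t' =>
          rcases h with h | ⟨j, h⟩ | ⟨⟨j, h⟩, -⟩
          · exact absurd h (HFModel.pair_ne_zero _ _)
          · exact absurd (HFModel.tag_inj.1 (HFModel.pair_inj.1 h).1) (by decide)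
          · exact absurd h.symm (HFModel.ord_ne_pair _ _ _)
    | rule h _ _ iha ihb =>
      obtain ⟨p, p', q, q', rfl, rfl, rfl⟩ := h
      obtain ⟨h, rfl⟩ := HFModel.pair_inj.1 hp
      cases t with
      | zero => exact absurd h.symm (HFModel.pair_ne_zero _ _)
      | var k => exact absurd h (HFModel.ord_ne_pair _ _ _)
      | ind k => exact absurd (HFModel.tag_inj.1 (HFModel.pair_inj.1 h).1) (by decide)
      | eats t u =>
        obtain ⟨rfl, rfl⟩ := HFModel.pair_inj.1 (HFModel.pair_inj.1 h).2
        rw [iha _ _ rfl, ihb _ _ rfl]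
        rfl
  · rintro rfl
    rw [StTerm]
    induction t with
    | zero => exact .base (.inr ⟨_, rfl, .inl rfl⟩)
    | var k =>
      by_cases h : i = k
      · subst h
        exact .base (.inl (by simp [Tm.replCode, Tm.code]))
      · refine .base (.inr ⟨ord (k + 1), by simp [Tm.replCode, Tm.code, h], .inr (.inr ⟨⟨k, rfl⟩, ?_⟩)⟩)
        rw [Ne, HFModel.ord_inj]
        omega
    | ind k => exact .base (.inr ⟨_, rfl, .inr (.inl ⟨k, rfl⟩)⟩)
    | eats t t' iht iht' => exact .rule ⟨_, _, _, _, rfl, rfl, rfl⟩ iht iht'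

/-- The relation expressed by `stAtomicP`. -/
def StAtomic (v u x x' : HFSet) : Prop :=
  ∃ p p' q q', StTerm v u p p' ∧ StTerm v u q q' ∧
    (x = eqCode p q ∧ x' = eqCode p' q' ∨ x = memCode p q ∧ x' = memCode p' q')

@[simp] theorem sat_stAtomicP (v u x x' : Tm n) : (stAtomicP v u x x').sat e b ↔
    StAtomic (v.val e b) (u.val e b) (x.val e b) (x'.val e b) := by
  simp [stAtomicP, StAtomic]

theorem stAtomic_iff (i : ℕ) (u x' : HFSet) (A : Fm n) :
    StAtomic (ord (i + 1)) u (A.code HFSet) x' ↔ ∃ t t' : Tm n,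
      (A = t EQ t' ∧ x' = eqCode (t.replCode i u) (t'.replCode i u)) ∨
        (A = t IN t' ∧ x' = memCode (t.replCode i u) (t'.replCode i u)) := by
  constructor
  · rintro ⟨p, p', q, q', hp, hq, ⟨h, h'⟩ | ⟨h, h'⟩⟩
    · cases A <;> simp only [Fm.code, memCode, eqCode, disjCode, negCode, exCode,
        HFModel.pair_inj, HFModel.tag_inj, OfNat.zero_ne_ofNat, false_and,
        Nat.reduceEqDiff, true_and] at h
      obtain ⟨rfl, rfl⟩ := h
      rw [stTerm_iff] at hp hq
      exact ⟨_, _, .inl ⟨rfl, by rw [h', hp, hq]⟩⟩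
    · cases A <;> simp only [Fm.code, memCode, eqCode, disjCode, negCode, exCode,
        HFModel.pair_inj, HFModel.tag_inj, OfNat.ofNat_ne_zero, false_and,
        true_and] at h
      obtain ⟨rfl, rfl⟩ := h
      rw [stTerm_iff] at hp hq
      exact ⟨_, _, .inr ⟨rfl, by rw [h', hp, hq]⟩⟩
  · rintro ⟨t, t', ⟨rfl, h⟩ | ⟨rfl, h⟩⟩
    · exact ⟨_, _, _, _, (stTerm_iff _ _ _ t).2 rfl, (stTerm_iff _ _ _ t').2 rfl, .inl ⟨rfl, h⟩⟩
    · exact ⟨_, _, _, _, (stTerm_iff _ _ _ t).2 rfl, (stTerm_iff _ _ _ t').2 rfl, .inr ⟨rfl, h⟩⟩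

/-! ### Substitution in formulas -/

/-- The relation expressed by `substFormP`. -/
def SubstForm (v u x x' : HFSet) : Prop :=
  (∃ i, v = ord (i + 1)) ∧ (∃ T : Tm 0, u = T.code HFSet) ∧
  Deriv (fun y => ∃ z z', y = pair z z' ∧ StAtomic v u z z')
    (fun a b y => ∃ p p', a = pair p p' ∧ (y = pair (negCode p) (negCode p') ∨
      y = pair (exCode p) (exCode p') ∨ ∃ q q', b = pair q q' ∧
        y = pair (disjCode p q) (disjCode p' q'))) (pair x x')

@[simp] theorem sat_substFormP (v u x x' : Tm n) : (substFormP v u x x').sat e b ↔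
    SubstForm (v.val e b) (u.val e b) (x.val e b) (x'.val e b) := by
  rw [substFormP, Fm.sat_conj, Fm.sat_conj, sat_varP, sat_termP,
    sat_derivP e b (fun y => ∃ z z', y = pair z z' ∧ StAtomic (v.val e b) (u.val e b) z z')
    (fun a b y => ∃ p p', a = pair p p' ∧ (y = pair (negCode p) (negCode p') ∨
      y = pair (exCode p) (exCode p') ∨ ∃ q q', b = pair q q' ∧
        y = pair (disjCode p q) (disjCode p' q'))) (by simp) (by simp)]
  rfl

/-- A term without indices, seen below `n` quantifiers. -/
def Tm.embed (n : ℕ) (T : Tm 0) : Tm n := T.inst fun k => k.elim0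

theorem Tm.embed_zero (T : Tm 0) : T.embed 0 = T :=
  (congrArg (fun σ => T.inst σ) (Subsingleton.elim _ _)).trans T.inst_ind

theorem Tm.lift_embed (T : Tm 0) : (T.embed n).lift = T.embed (n + 1) :=
  (Tm.lift_inst _ T).trans (congrArg (fun σ => T.inst σ) (Subsingleton.elim _ _))

theorem Tm.code_embed (T : Tm 0) : (T.embed n).code HFSet = T.code HFSet := by
  induction T with
  | ind k => exact k.elim0
  | eats T U ihT ihU =>
    simp only [Tm.embed] at ihT ihU
    simp only [Tm.embed, Tm.inst, Tm.code, ihT, ihU]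
  | _ => rfl

/-- The coded substitution uses the same `u` below quantifiers, whereas `Fm.subst` lifts the term.
They agree since a term without indices has the same code at every depth (`Tm.code_embed`). -/
theorem substForm_iff (i : ℕ) (T : Tm 0) (A : Fm 0) (x' : HFSet) :
    SubstForm (ord (i + 1)) (T.code HFSet) (A.code HFSet) x' ↔
      x' = (A.subst i T).code HFSet := by
  have h0 := congrArg (fun U => (A.subst i U).code HFSet) T.embed_zero
  beta_reduce at h0
  rw [← h0]
  clear h0
  constructor
  · rintro ⟨-, -, h⟩
    generalize hp : pair (A.code HFSet) x' = y at h
    -- The depth must vary, as the `ex` case passes to `Fm (n + 1)`; this is why `T` has been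
    -- replaced by its embedding.
    generalize 0 = n at A
    induction h generalizing n x' with
    | base h =>
      rw [← T.code_embed (n := n)] at h
      obtain ⟨z, z', rfl, h⟩ := h
      obtain ⟨rfl, rfl⟩ := HFModel.pair_inj.1 hp
      rw [stAtomic_iff] at h
      obtain ⟨t, t', ⟨rfl, h⟩ | ⟨rfl, h⟩⟩ := h <;>
        simp [h, Tm.replCode_code, Fm.subst, Fm.code]
    | rule h _ _ iha ihb =>
      obtain ⟨p, p', rfl, rfl | rfl | ⟨q, q', rfl, rfl⟩⟩ := h <;>
        obtain ⟨h, rfl⟩ := HFModel.pair_inj.1 hp <;> cases A <;>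
        simp only [Fm.code, memCode, eqCode, disjCode, negCode, exCode, HFModel.pair_inj,
          HFModel.tag_inj, OfNat.zero_ne_ofNat, false_and,
          Nat.reduceEqDiff, true_and] at h
      · subst h
        rw [iha _ _ _ rfl]
        rfl
      · subst h
        rw [iha _ _ _ rfl, Fm.subst, Tm.lift_embed]
        rfl
      · obtain ⟨rfl, rfl⟩ := h
        rw [iha _ _ _ rfl, ihb _ _ _ rfl]
        rfl
  · rintro rfl
    refine ⟨⟨i, rfl⟩, ⟨T, rfl⟩, ?_⟩
    suffices ∀ (n : ℕ) (A : Fm n), Deriv _ _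
      (pair (A.code HFSet) ((A.subst i (T.embed n)).code HFSet)) from this 0 A
    intro n A
    induction A with
    | @mem n t t' =>
      rw [← T.code_embed (n := n)]
      exact .base ⟨_, _, rfl, (stAtomic_iff _ _ _ _).2
        ⟨t, t', .inr ⟨rfl, by simp [Tm.replCode_code, Fm.subst, Fm.code]⟩⟩⟩
    | @eq n t t' =>
      rw [← T.code_embed (n := n)]
      exact .base ⟨_, _, rfl, (stAtomic_iff _ _ _ _).2
        ⟨t, t', .inl ⟨rfl, by simp [Tm.replCode_code, Fm.subst, Fm.code]⟩⟩⟩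
    | disj A B ihA ihB =>
      exact .rule ⟨_, _, rfl, .inr (.inr ⟨_, _, rfl, rfl⟩)⟩ ihA ihB
    | neg A ih => exact .rule ⟨_, _, rfl, .inl rfl⟩ ih ih
    | ex A ih =>
      rw [Fm.subst, Tm.lift_embed]
      exact .rule ⟨_, _, rfl, .inr (.inl rfl)⟩ ih ih

/-! ### Abstraction -/

/-- The relation expressed by `abstFormP`. -/
def AbstForm (v i x x' : HFSet) : Prop :=
  (∃ k, v = ord (k + 1)) ∧ (∃ k, i = ord k) ∧
  Deriv (fun y => ∃ d z z', y = pair d (pair z z') ∧ (∃ k, d = ord k) ∧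
      StAtomic v (indCode d) z z')
    (fun a b y => ∃ d p p', (a = pair d (pair p p') ∧
      (y = pair d (pair (negCode p) (negCode p')) ∨ ∃ q q', b = pair d (pair q q') ∧
        y = pair d (pair (disjCode p q) (disjCode p' q')))) ∨
      (a = pair (HFStruct.eats d d) (pair p p') ∧ y = pair d (pair (exCode p) (exCode p'))))
    (pair i (pair x x'))

@[simp] theorem sat_abstFormP (v i x x' : Tm n) : (abstFormP v i x x').sat e b ↔
    AbstForm (v.val e b) (i.val e b) (x.val e b) (x'.val e b) := by
  rw [abstFormP, Fm.sat_conj, Fm.sat_conj, sat_varP, sat_ordP,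
    sat_derivP e b (fun y => ∃ d z z', y = pair d (pair z z') ∧ (∃ k, d = ord k) ∧
      StAtomic (v.val e b) (indCode d) z z')
    (fun a b y => ∃ d p p', (a = pair d (pair p p') ∧
      (y = pair d (pair (negCode p) (negCode p')) ∨ ∃ q q', b = pair d (pair q q') ∧
        y = pair d (pair (disjCode p q) (disjCode p' q')))) ∨
      (a = pair (HFStruct.eats d d) (pair p p') ∧ y = pair d (pair (exCode p) (exCode p'))))
    (by simp) (by simp)]
  rfl

theorem abstForm_iff (i : ℕ) (A : Fm 0) (x' : HFSet) :
    AbstForm (ord (i + 1)) HFStruct.zero (A.code HFSet) x' ↔ x' = (A.abst i).code HFSet := by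
  -- Written as `ord 0`, the depth counter of the coded relation can be generalised together with
  -- the depth in the type of `A`.
  rw [show (HFStruct.zero : HFSet) = ord 0 from rfl]
  constructor
  · rintro ⟨-, -, h⟩
    generalize hp : pair (ord 0) (pair (A.code HFSet) x') = y at h
    generalize 0 = n at A hp
    induction h generalizing n x' with
    | base h =>
      obtain ⟨d, z, z', rfl, -, h⟩ := h
      simp only [HFModel.pair_inj] at hp
      obtain ⟨rfl, rfl, rfl⟩ := hp
      rw [stAtomic_iff] at h
      obtain ⟨t, t', ⟨rfl, h⟩ | ⟨rfl, h⟩⟩ := h <;>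
        simp [h, Tm.replCode_indCode, Fm.abst, Fm.code]
    | rule h _ _ iha ihb =>
      obtain ⟨d, p, p', ⟨rfl, rfl | ⟨q, q', rfl, rfl⟩⟩ | ⟨rfl, rfl⟩⟩ := h <;>
        rw [HFModel.pair_inj, HFModel.pair_inj] at hp <;>
        obtain ⟨rfl, h, rfl⟩ := hp <;> cases A <;>
        simp only [Fm.code, memCode, eqCode, disjCode, negCode, exCode, HFModel.pair_inj,
          HFModel.tag_inj, OfNat.zero_ne_ofNat, false_and,
          Nat.reduceEqDiff, true_and] at h
      · subst h
        rw [iha _ _ _ rfl]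
        rfl
      · obtain ⟨rfl, rfl⟩ := h
        rw [iha _ _ _ rfl, ihb _ _ _ rfl]
        rfl
      · subst h
        rw [iha _ (_ + 1) _ rfl]
        rfl
  · rintro rfl
    refine ⟨⟨i, rfl⟩, ⟨0, rfl⟩, ?_⟩
    generalize 0 = n at A
    induction A with
    | @mem n t t' =>
      exact .base ⟨_, _, _, rfl, ⟨n, rfl⟩, (stAtomic_iff _ _ _ _).2
        ⟨t, t', .inr ⟨rfl, by simp [Tm.replCode_indCode, Fm.abst, Fm.code]⟩⟩⟩
    | @eq n t t' =>
      exact .base ⟨_, _, _, rfl, ⟨n, rfl⟩, (stAtomic_iff _ _ _ _).2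
        ⟨t, t', .inl ⟨rfl, by simp [Tm.replCode_indCode, Fm.abst, Fm.code]⟩⟩⟩
    | disj A B ihA ihB =>
      exact .rule ⟨_, _, _, .inl ⟨rfl, .inr ⟨_, _, rfl, rfl⟩⟩⟩ ihA ihB
    | neg A ih => exact .rule ⟨_, _, _, .inl ⟨rfl, .inl rfl⟩⟩ ih ih
    | ex A ih => exact .rule ⟨_, _, _, .inr ⟨rfl, rfl⟩⟩ ih ih

theorem AbstForm.exists_var {v x x' : HFSet} (h : AbstForm v HFStruct.zero x x') :
    ∃ i, v = ord (i + 1) := h.1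

/-! ### Formulas -/

/-- The number of connectives and quantifiers. -/
def Fm.size : {n : ℕ} → Fm n → ℕ
  | _, .mem _ _ => 0
  | _, .eq _ _ => 0
  | _, .disj A B => A.size + B.size + 1
  | _, .neg A => A.size + 1
  | _, .ex A => A.size + 1

theorem Fm.size_inst {n : ℕ} (A : Fm n) {m : ℕ} (σ : Fin n → Tm m) :
    (A.inst σ).size = A.size := by
  induction A generalizing m <;> simp_all [Fm.inst, Fm.size]

/-- The coded formation rule reaches `∃` only by abstracting a formula of `Fm 0`. The body of a
quantifier has to be opened with a fresh variable, so `sat_formP` proceeds by induction on size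
instead of structure. -/
theorem Fm.exists_abst_eq (B : Fm 1) : ∃ (A : Fm 0) (i : ℕ), A.abst i = B ∧ A.size = B.size := by
  obtain ⟨i, hi⟩ := exists_fresh B.fv
  exact ⟨_, i, Fm.abst_inst_var hi, Fm.size_inst _ _⟩

@[simp] theorem sat_atomicP (x : Tm n) : (atomicP x).sat e b ↔
    ∃ T U : Tm 0, x.val e b = eqCode (T.code HFSet) (U.code HFSet) ∨
      x.val e b = memCode (T.code HFSet) (U.code HFSet) := by
  simp only [atomicP, sat_exB, Fm.sat_conj, sat_termP, Fm.sat_disj, Fm.sat_eq, val_qEq, val_qMem,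
    Tm.val_lift, Tm.val_ind, Fin.cons_zero]
  constructor
  · rintro ⟨_, _, ⟨T, rfl⟩, ⟨U, rfl⟩, h⟩
    exact ⟨T, U, h⟩
  · rintro ⟨T, U, h⟩
    exact ⟨_, _, ⟨T, rfl⟩, ⟨U, rfl⟩, h⟩

@[simp] theorem sat_makeFormP (y u w : Tm n) : (makeFormP y u w).sat e b ↔
    y.val e b = disjCode (u.val e b) (w.val e b) ∨ y.val e b = negCode (u.val e b) ∨
      ∃ v u', AbstForm v HFStruct.zero (u.val e b) u' ∧ y.val e b = exCode u' := by
  simp [makeFormP]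

@[simp] theorem sat_formP (y : Tm n) :
    (formP y).sat e b ↔ ∃ A : Fm 0, y.val e b = A.code HFSet := by
  rw [formP, sat_derivP e b (fun x => ∃ T U : Tm 0, x = eqCode (T.code HFSet) (U.code HFSet) ∨
      x = memCode (T.code HFSet) (U.code HFSet))
    (fun u w y => y = disjCode u w ∨ y = negCode u ∨
      ∃ v u', AbstForm v HFStruct.zero u u' ∧ y = exCode u') (by simp) (by simp)]
  generalize y.val e b = x
  constructor
  · intro h
    induction h with
    | base h =>
      obtain ⟨T, U, rfl | rfl⟩ := h
      exacts [⟨.eq T U, rfl⟩, ⟨.mem T U, rfl⟩]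
    | rule h _ _ iha ihb =>
      obtain ⟨A, rfl⟩ := iha
      obtain ⟨B, rfl⟩ := ihb
      rcases h with rfl | rfl | ⟨v, u', h, rfl⟩
      · exact ⟨.disj A B, rfl⟩
      · exact ⟨.neg A, rfl⟩
      · obtain ⟨i, rfl⟩ := h.exists_var
        rw [abstForm_iff] at h
        exact ⟨.exN i A, by rw [h]; rfl⟩
  · rintro ⟨A, rfl⟩
    induction hs : A.size using Nat.strong_induction_on generalizing A with
    | _ s ih =>
    cases A with
    | mem t u => exact .base ⟨t, u, .inr rfl⟩
    | eq t u => exact .base ⟨t, u, .inl rfl⟩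
    | disj A B =>
      simp only [Fm.size] at hs
      exact .rule (.inl rfl) (ih A.size (by omega) A rfl) (ih B.size (by omega) B rfl)
    | neg A =>
      simp only [Fm.size] at hs
      have := ih A.size (by omega) A rfl
      exact .rule (.inr (.inl rfl)) this this
    | ex B =>
      simp only [Fm.size] at hs
      obtain ⟨A, i, rfl, hA⟩ := B.exists_abst_eq
      have := ih A.size (by omega) A rfl
      exact .rule (.inr (.inr ⟨_, _, (abstForm_iff i A _).2 rfl, rfl⟩)) this this

theorem Fm.subst_of_notMem {i : ℕ} {A : Fm n} (h : i ∉ A.fv) (x : Tm n) : A.subst i x = A := by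
  induction A <;> simp_all [Fm.subst, Fm.fv, Tm.subst_of_notMem]

theorem substForm_zero_self_iff (i : ℕ) (A : Fm 0) :
    SubstForm (ord (i + 1)) HFStruct.zero (A.code HFSet) (A.code HFSet) ↔ i ∉ A.fv := by
  refine (substForm_iff i .zero A _).trans ?_
  rw [Fm.code_injective.eq_iff]
  exact ⟨fun h => Fm.notMem_fv_of_subst_eq h.symm, fun h => (Fm.subst_of_notMem h _).symm⟩

@[simp] theorem sat_varNonOccFormP (v x : Tm n) : (varNonOccFormP v x).sat e b ↔
    (∃ A : Fm 0, x.val e b = A.code HFSet) ∧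
      SubstForm (v.val e b) HFStruct.zero (x.val e b) (x.val e b) := by
  simp [varNonOccFormP]

end CodedSyntax

/-! ## The coded calculus -/

section Calculus

variable {n : ℕ} (e : ℕ → HFSet) (b : Fin n → HFSet)

theorem Fm.code_imp (A B : Fm 0) : (A IMP B).code HFSet = impCode (A.code HFSet) (B.code HFSet) :=
  rfl

theorem Fm.code_allN (i : ℕ) (A : Fm 0) :
    (Fm.allN i A).code HFSet = allCode ((A.abst i).code HFSet) := rfl

@[simp] theorem sat_booleanAxP (y : Tm n) :
    (booleanAxP y).sat e b ↔ ∃ A, BooleanAx A ∧ y.val e b = A.code HFSet := by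
  simp only [booleanAxP, sat_exB, Fm.sat_conj, sat_formP, Fm.sat_disj, Fm.sat_eq, val_qImp,
    val_qDisj, val_qNeg, Tm.val_lift, Tm.val_ind, Fin.cons_zero]
  constructor
  · rintro ⟨_, _, _, ⟨A, rfl⟩, ⟨B, rfl⟩, ⟨C, rfl⟩, h⟩
    rcases h with h | h | h | h | h
    exacts [⟨_, .ident A, h⟩, ⟨_, .disjI1 A B, h⟩, ⟨_, .disjCont A, h⟩, ⟨_, .disjAssoc A B C, h⟩,
      ⟨_, .disjConj A B C, h⟩]
  · rintro ⟨_, h, hy⟩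
    cases h with
    | ident A => exact ⟨_, _, _, ⟨A, rfl⟩, ⟨A, rfl⟩, ⟨A, rfl⟩, .inl hy⟩
    | disjI1 A B => exact ⟨_, _, _, ⟨A, rfl⟩, ⟨B, rfl⟩, ⟨A, rfl⟩, .inr (.inl hy)⟩
    | disjCont A => exact ⟨_, _, _, ⟨A, rfl⟩, ⟨A, rfl⟩, ⟨A, rfl⟩, .inr (.inr (.inl hy))⟩
    | disjAssoc A B C =>
      exact ⟨_, _, _, ⟨A, rfl⟩, ⟨B, rfl⟩, ⟨C, rfl⟩, .inr (.inr (.inr (.inl hy)))⟩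
    | disjConj A B C =>
      exact ⟨_, _, _, ⟨A, rfl⟩, ⟨B, rfl⟩, ⟨C, rfl⟩, .inr (.inr (.inr (.inr hy)))⟩

@[simp] theorem sat_equalityAxP (y : Tm n) :
    (equalityAxP y).sat e b ↔ ∃ A, EqualityAx A ∧ y.val e b = A.code HFSet := by
  simp [equalityAxP, EqualityAx, or_and_right, exists_or]

@[simp] theorem sat_hfAxP (y : Tm n) :
    (hfAxP y).sat e b ↔ ∃ A, HFAx A ∧ y.val e b = A.code HFSet := by
  simp [hfAxP, HFAx, or_and_right, exists_or]

@[simp] theorem sat_specialAxP (y : Tm n) :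
    (specialAxP y).sat e b ↔ ∃ A, SpecialAx A ∧ y.val e b = A.code HFSet := by
  simp only [specialAxP, sat_exB, Fm.sat_conj, sat_varP, sat_termP, sat_formP, sat_substFormP,
    sat_abstFormP, Fm.sat_eq, val_qImp, val_qEx, Tm.val_lift, Tm.val_ind, Fin.cons_zero,
    Tm.val_zero]
  constructor
  · rintro ⟨_, _, _, sx, ax, ⟨i, rfl⟩, ⟨T, rfl⟩, ⟨A, rfl⟩, hs, ha, h⟩
    rw [substForm_iff] at hs
    rw [abstForm_iff] at ha
    exact ⟨_, .intro A i T, by rw [h, hs, ha]; rfl⟩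
  · rintro ⟨_, ⟨A, i, T⟩, hy⟩
    exact ⟨_, _, _, _, _, ⟨i, rfl⟩, ⟨T, rfl⟩, ⟨A, rfl⟩, (substForm_iff _ _ _ _).2 rfl,
      (abstForm_iff _ _ _).2 rfl, hy⟩

@[simp] theorem sat_inductionAxP (y : Tm n) :
    (inductionAxP y).sat e b ↔ ∃ A, InductionAx A ∧ y.val e b = A.code HFSet := by
  simp only [inductionAxP, sat_exB, Fm.sat_conj, sat_varP, sat_varNonOccFormP, sat_substFormP,
    sat_abstFormP, Fm.sat_eq, Fm.sat_neg, val_qImp, val_qAll, val_qEats, Tm.val_lift, Tm.val_ind,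
    Fin.cons_zero, Tm.val_zero]
  constructor
  · rintro ⟨_, _, _, x0, xw, xvw, allw, allvw, ax, ⟨i, rfl⟩, ⟨j, rfl⟩, hij, ⟨⟨A, rfl⟩, hj⟩, h0, hw,
      hvw, hallw, hallvw, hax, h⟩
    have hij' : j ≠ i := fun h => hij (by rw [h])
    rw [substForm_zero_self_iff] at hj
    obtain rfl := (substForm_iff i .zero A _).1 h0
    obtain rfl := (substForm_iff i (.var j) A _).1 hw
    obtain rfl := (substForm_iff i (.eats (.var i) (.var j)) A _).1 hvw
    rw [← Fm.code_imp, ← Fm.code_imp, abstForm_iff] at hallw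
    subst hallw
    rw [← Fm.code_allN, abstForm_iff] at hallvw
    subst hallvw
    obtain rfl := (abstForm_iff i A _).1 hax
    exact ⟨_, .intro A i j hij' hj, h⟩
  · rintro ⟨_, ⟨A, i, j, hij, hj⟩, hy⟩
    let S : Fm 0 := A IMP (A.subst i (.var j) IMP A.subst i (.eats (.var i) (.var j)))
    refine ⟨ord (i + 1), ord (j + 1), A.code HFSet, (A.subst i .zero).code HFSet,
      (A.subst i (.var j)).code HFSet, (A.subst i (.eats (.var i) (.var j))).code HFSet,
      (S.abst j).code HFSet, ((Fm.allN j S).abst i).code HFSet, (A.abst i).code HFSet,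
      ⟨i, rfl⟩, ⟨j, rfl⟩, ?_, ⟨⟨A, rfl⟩, (substForm_zero_self_iff j A).2 hj⟩,
      (substForm_iff i .zero A _).2 rfl, (substForm_iff i (.var j) A _).2 rfl,
      (substForm_iff i (.eats (.var i) (.var j)) A _).2 rfl, (abstForm_iff j S _).2 rfl,
      (abstForm_iff i (.allN j S) _).2 rfl, (abstForm_iff i A _).2 rfl, hy⟩
    rw [HFModel.ord_inj]
    omega

/-- The axioms of the calculus with the extra axiom `E`. -/
def Ax (E A : Fm 0) : Prop :=
  A = E ∨ BooleanAx A ∨ EqualityAx A ∨ HFAx A ∨ SpecialAx A ∨ InductionAx A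

theorem Ax.thm {E A : Fm 0} (h : Ax E A) : HFThm E ∅ A := by
  rcases h with rfl | h | h | h | h | h
  exacts [.extra, .bool h, .eq h, .hf h, .spec h, .ind h]

@[simp] theorem sat_axiomP (E : Fm 0) (y : Tm n) :
    (axiomP E y).sat e b ↔ ∃ A, Ax E A ∧ y.val e b = A.code HFSet := by
  simp [axiomP, Ax, or_and_right, exists_or]

/-- The coded rules of inference. -/
def Rule (x y z : HFSet) : Prop :=
  y = impCode x z ∨
  (∃ v p p' q, (∃ i, v = ord (i + 1)) ∧ (∃ A : Fm 0, p = A.code HFSet) ∧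
    ((∃ A : Fm 0, q = A.code HFSet) ∧ SubstForm v HFStruct.zero q q) ∧
    AbstForm v HFStruct.zero p p' ∧ x = impCode p q ∧ z = impCode (exCode p') q) ∨
  ∃ v u, (∃ i, v = ord (i + 1)) ∧ (∃ T : Tm 0, u = T.code HFSet) ∧ SubstForm v u x z

theorem sat_rules (x y z : Tm n) :
    (modPonP x y z OR existsP x z OR substP x z).sat e b ↔
      Rule (x.val e b) (y.val e b) (z.val e b) := by
  simp only [modPonP, existsP, substP, Rule, sat_exB, Fm.sat_disj, Fm.sat_conj, Fm.sat_eq, sat_varP,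
    sat_termP, sat_formP, sat_varNonOccFormP, sat_abstFormP, sat_substFormP, val_qImp, val_qEx,
    Tm.val_lift, Tm.val_ind, Fin.cons_zero, Tm.val_zero]

theorem sat_pfP (E : Fm 0) (t : Tm n) : (pfP E t).sat e b ↔
    Deriv (fun x => ∃ A, Ax E A ∧ x = A.code HFSet) Rule (t.val e b) := by
  rw [pfP, sat_derivP e b (fun x => ∃ A, Ax E A ∧ x = A.code HFSet) Rule (by simp)
    (fun _ _ _ _ _ _ _ _ => (sat_rules _ _ _ _ _).trans (by simp))]

theorem Fm.exists_of_code_eq_disj {A : Fm 0} {x y : HFSet} (h : A.code HFSet = disjCode x y) :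
    ∃ B C, A = B OR C ∧ x = B.code HFSet ∧ y = C.code HFSet := by
  cases A <;> simp only [Fm.code, memCode, eqCode, disjCode, negCode, exCode, HFModel.pair_inj,
    HFModel.tag_inj, OfNat.zero_ne_ofNat, false_and,
    Nat.reduceEqDiff, true_and] at h
  exact ⟨_, _, rfl, h.1.symm, h.2.symm⟩

/-- Injectivity of codes recovers the formulas from a coded inference. The coded substitution rule,
which is not primitive in the calculus, is justified by `HFThm.subst`. -/
theorem Deriv.thm {E : Fm 0} {x : HFSet}
    (h : Deriv (fun x => ∃ A, Ax E A ∧ x = A.code HFSet) Rule x) :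
    ∃ A, x = A.code HFSet ∧ HFThm E ∅ A := by
  induction h with
  | base h =>
    obtain ⟨A, hA, rfl⟩ := h
    exact ⟨A, rfl, hA.thm⟩
  | rule h _ _ iha ihb =>
    obtain ⟨A, rfl, hA⟩ := iha
    obtain ⟨B, rfl, hB⟩ := ihb
    rcases h with h | ⟨_, _, _, _, ⟨i, rfl⟩, ⟨P, rfl⟩, ⟨⟨Q, rfl⟩, hQ⟩, hP, hx, rfl⟩ |
      ⟨_, _, ⟨i, rfl⟩, ⟨T, rfl⟩, h⟩
    · obtain ⟨A', C, rfl, h1, rfl⟩ := Fm.exists_of_code_eq_disj h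
      obtain rfl : A.neg = A' := Fm.code_injective h1
      exact ⟨C, rfl, .mp_same hB hA⟩
    · obtain rfl : A = P IMP Q := Fm.code_injective hx
      rw [substForm_zero_self_iff] at hQ
      rw [abstForm_iff] at hP
      subst hP
      exact ⟨.exN i P IMP Q, rfl, .exists hA hQ (by simp)⟩
    · rw [substForm_iff] at h
      exact ⟨_, h, hA.subst i T⟩

/-- Emptiness is a separate equation so that induction can pass through modus ponens, where a union
is empty only if both parts are. -/
theorem HFThm.deriv {E : Fm 0} {H : Set (Fm 0)} {A : Fm 0} (h : HFThm E H A) (hH : H = ∅) :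
    Deriv (fun x => ∃ A, Ax E A ∧ x = A.code HFSet) Rule (A.code HFSet) := by
  induction h with
  | hyp h => simp [hH] at h
  | extra => exact .base ⟨_, .inl rfl, rfl⟩
  | bool h => exact .base ⟨_, .inr (.inl h), rfl⟩
  | eq h => exact .base ⟨_, .inr (.inr (.inl h)), rfl⟩
  | spec h => exact .base ⟨_, .inr (.inr (.inr (.inr (.inl h)))), rfl⟩
  | hf h => exact .base ⟨_, .inr (.inr (.inr (.inl h))), rfl⟩
  | ind h => exact .base ⟨_, .inr (.inr (.inr (.inr (.inr h)))), rfl⟩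
  | mp _ _ ih₁ ih₂ =>
    rw [Set.union_empty_iff] at hH
    -- The coded modus ponens takes the minor premise first.
    exact .rule (.inl rfl) (ih₂ hH.2) (ih₁ hH.1)
  | _ h hB hC ih =>
    rename_i H A B i
    exact .rule (.inr (.inl ⟨_, _, _, _, ⟨i, rfl⟩, ⟨A, rfl⟩,
      ⟨⟨B, rfl⟩, (substForm_zero_self_iff i B).2 hB⟩, (abstForm_iff i A _).2 rfl, rfl, rfl⟩))
      (ih hH) (ih hH)

/-- The provability predicate is adequate. -/
theorem sat_pfP_quot_iff (E A : Fm 0) : (pfP E A.quot).sat e b ↔ HFThm E ∅ A := by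
  rw [sat_pfP, Fm.val_quot]
  constructor
  · intro h
    obtain ⟨B, hB, h⟩ := h.thm
    rwa [Fm.code_injective hB]
  · exact fun h => h.deriv rfl

end Calculus

end HFCalculus

/-! ### The incompleteness theorem -/

theorem mainTheorem1 (E : HFCalculus.Fm 0)
    (hE : ∀ e : ℕ → HFSet, E.Holds e)
    (hcon : ¬ HFCalculus.HFThm E ∅ HFCalculus.Fm.fls) :
    ∃ δ : HFCalculus.Fm 0,
      HFCalculus.HFThm E ∅ (δ.iff (HFCalculus.pfP E δ.quot).neg) ∧
      ¬ HFCalculus.HFThm E ∅ δ ∧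
      ¬ HFCalculus.HFThm E ∅ δ.neg ∧
      (∀ e : ℕ → HFSet, δ.Holds e) ∧
      δ.Ground := by
  -- The fixed point, read in HF, combined with adequacy: truth of the sentence is its own
  -- unprovability.
  have key (e : ℕ → HFSet) : (HFCalculus.goedelSentence E).sat e Fin.elim0 ↔
      ¬ HFCalculus.HFThm E ∅ (HFCalculus.goedelSentence E) := by
    rw [HFCalculus.sat_goedelSentence, HFCalculus.sat_pfP_quot_iff]
  have hδ : ¬ HFCalculus.HFThm E ∅ (HFCalculus.goedelSentence E) := fun h =>
    (key fun _ => HFSet.empty).1 (h.sound hE _ _ (by simp)) h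
  refine ⟨_, HFCalculus.goedelSentence_fixed_point E, hδ, fun h => ?_, fun e => ?_,
    HFCalculus.goedelSentence_ground E⟩
  · exact h.sound hE (fun _ => HFSet.empty) Fin.elim0 (by simp) ((key _).2 hδ)
  · exact (HFCalculus.Fm.sat_iff_eval e _ _).1 ((key e).2 hδ)
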